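/- Let $0<\theta<1$, let $\mathbb B^2\subset\mathbb R^2$ be the open unit disc, and define $A:\mathbb R^2\to\mathbb R^2$ by $$A(\eta)=\begin{pmatrix}1+\sqrt\theta\,\sin(\pi\eta_1)&0\\0&1+\sqrt\theta\,\sin(\pi\eta_2)\end{pmatrix}\begin{pmatrix}\eta_1\\\eta_2\end{pmatrix},\qquad \eta=(\eta_1,\eta_2)\in\mathbb R^2 .$$ Let $$\bar q=\sup_{L\in\{2,4,6,\dots\}}\left(1-\frac1{1+L}+\frac1{1+L(1-\theta)}\right).$$ Then for every $r\in(1,\bar q)$ there is a function $u\in W^{1,r}_0(\mathbb B^2)$ (the closure of $C_c^\infty(\mathbb B^2)$ in $W^{1,r}(\mathbb B^2)$), not almost everywhere equal to $0$, which is a weak solution of $\operatorname{div}(A(\nabla u))=0$ in $\mathbb B^2$, that is, $$\int_{\mathbb B^2}\langle A(\nabla u),\nabla\varphi\rangle\,dx=0\qquad\text{for all }\varphi\in C_c^\infty(\mathbb B^2),$$ where $\nabla u$ is the weak gradient of $u$. Since $u\equiv0$ is also a solution in $W^{1,r}_0(\mathbb B^2)$, solutions of the Dirichlet problem $\operatorname{div}(A(\nabla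 u))=0$ in $\mathbb B^2$, $u=0$ on $\partial\mathbb B^2$, are not unique in $W^{1,r}_0(\mathbb B^2)$. -/

import Mathlib

open MeasureTheory Filter Topology TopologicalSpace Set
open scoped ENNReal Distributions Gradient InnerProductSpace

/-- The Euclidean plane. -/
abbrev Plane : Type := EuclideanSpace ℝ (Fin 2)

/-- The open unit disc `𝔹²`, as an open set. -/
def unitDisc : Opens Plane := ⟨Metric.ball 0 1, Metric.isOpen_ball⟩

/-- The vector field `A(η) = diag(1 + √θ sin(π η₁), 1 + √θ sin(π η₂)) η`. -/
noncomputable def fieldA (θ : ℝ) (η : Plane) : Plane :=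
  !₂[(1 + √θ * Real.sin (Real.pi * η 0)) * η 0,
     (1 + √θ * Real.sin (Real.pi * η 1)) * η 1]

/-- The threshold exponent: the supremum over the positive even integers `L` of
`1 - 1/(1+L) + 1/(1+L(1-θ))`. -/
noncomputable def qBar (θ : ℝ) : ℝ :=
  sSup {q : ℝ | ∃ L : ℕ, 0 < L ∧ Even L ∧
    q = 1 - 1 / (1 + (L : ℝ)) + 1 / (1 + (L : ℝ) * (1 - θ))}

/-- `g` is the weak (distributional) gradient of `u` on the open set `Ω`: both are locally
integrable on `Ω` and `∫_Ω u ∇φ = -∫_Ω φ g` for all `φ ∈ C_c^∞(Ω)`. -/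
def HasWeakGradient (Ω : Opens Plane) (u : Plane → ℝ) (g : Plane → Plane) : Prop :=
  LocallyIntegrableOn u Ω volume ∧ LocallyIntegrableOn g Ω volume ∧
    ∀ φ : 𝓓(Ω, ℝ), ∫ x in (Ω : Set Plane), u x • ∇ φ x = -∫ x in (Ω : Set Plane), φ x • g x

/-- `u ∈ W^{1,p}_0(Ω)`: `u` belongs to `W^{1,p}(Ω)` and is the limit, in the norm of `W^{1,p}(Ω)`,
of a sequence of functions in `C_c^∞(Ω)`. -/
def MemSobolevZero (Ω : Opens Plane) (p : ℝ≥0∞) (u : Plane → ℝ) : Prop :=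
  MemLp u p (volume.restrict Ω) ∧
    ∃ g : Plane → Plane, HasWeakGradient Ω u g ∧ MemLp g p (volume.restrict Ω) ∧
      ∃ φ : ℕ → 𝓓(Ω, ℝ),
        Tendsto (fun n => eLpNorm (fun x => φ n x - u x) p (volume.restrict Ω)) atTop (𝓝 0) ∧
        Tendsto (fun n => eLpNorm (fun x => ∇ (φ n) x - g x) p (volume.restrict Ω)) atTop (𝓝 0)

/-- `u` is a weak (distributional) solution of `div (A(∇u)) = 0` in `Ω`, where `∇u` is the weak
gradient of `u`. -/
def IsWeakSolution (Ω : Opens Plane) (A : Plane → Plane) (u : Plane → ℝ) : Prop :=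
  ∃ g : Plane → Plane, HasWeakGradient Ω u g ∧
    LocallyIntegrableOn (fun x => A (g x)) Ω volume ∧
    ∀ φ : 𝓓(Ω, ℝ), ∫ x in (Ω : Set Plane), ⟪A (g x), ∇ φ x⟫_ℝ = 0

/-- `u ∈ W^{1,p}_0(Ω)` is a weak solution of the Dirichlet problem `div (A(∇u)) = 0` in `Ω`,
`u = 0` on `∂Ω`. -/
def IsDirichletSolution (Ω : Opens Plane) (A : Plane → Plane) (p : ℝ≥0∞) (u : Plane → ℝ) : Prop :=
  MemSobolevZero Ω p u ∧ IsWeakSolution Ω A u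

/-! The proof is convex integration driven by staircase laminates. On a simply connected domain the
equation says that `A(∇u)` is a rotated gradient `(∂₂ψ, -∂₁ψ)`, so with `x = ∂₁u`, `s = ∂₂ψ`, `y =
∂₂u`, `t = -∂₁ψ` and `κ = √θ` it becomes the inclusion `s = wave κ x`, `t = wave κ y` for `D(u, ψ)`.
Changing any one of these four numbers is a rank-one change of the matrix `D(u, ψ)`. Hence every
relaxed energy is separately convex in `(x, s)` and in `(y, t)`, and the matrix problem reduces to a
scalar problem about the graph of `wave κ`.

In the scalar problem, the graph touches the lines of slope `1 + κ` and `1 - κ` along arithmetic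
progressions. A staircase alternates horizontal and vertical splittings; each step leaves some mass
on the graph, at distance of order `j` from the origin, and passes the rest to the next corner. The
surviving fraction behaves like `(j / (j + 1)) ^ r'` for every `r'` below `L/(1+L) + (1+κ)/((1+κ) +
(1-κ)L)`, so for `r < r'` the `r`-th moment stays finite. This gives `separatelyConvex_envelope_le`:
any point reaches the graph at an `r`-th power cost bounded by a constant times its weighted
deviation `defect`. The constant does not depend on the penalty `K` for missing the graph.

Laminates become smooth maps through `exists_lamination` and `exists_refinement`, which yield the
convexity of `relaxed` along coordinate rank-one lines (`convexOn_relaxed`). In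
`exists_convex_integration_step` the total defect is then made arbitrarily small, while the gradient
of `u` moves in `L^r` by an amount controlled by the old defect and the map itself moves little
uniformly.

Iterating from a cutoff function gives gradients of `u` that are Cauchy in `L^r` and functions that
converge uniformly, with total change at most `1/2`, so the limit is not zero. The field `A(∇u)`
passes to the limit in `L¹` along a subsequence, and rotated gradients are divergence free, so the
limit solves the equation; the potentials `ψ` themselves need not converge. -/

/-! ### Separate convexity and staircase laminates. -/

/-- Convexity in each variable separately. -/
def SeparatelyConvex (g : ℝ → ℝ → ℝ) : Prop :=
  (∀ s, ConvexOn ℝ univ fun x => g x s) ∧ ∀ x, ConvexOn ℝ univ (g x)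

theorem ConvexOn.le_combination {h : ℝ → ℝ} (hh : ConvexOn ℝ univ h) {a b z l : ℝ}
    (hl0 : 0 ≤ l) (hl1 : l ≤ 1) (hz : z = (1 - l) * a + l * b) :
    h z ≤ (1 - l) * h a + l * h b := by
  have := hh.2 (mem_univ a) (mem_univ b) (sub_nonneg.2 hl1) hl0 (by ring)
  simpa [hz] using this

theorem ConvexOn.le_max_of_between {h : ℝ → ℝ} (hh : ConvexOn ℝ univ h) {a b z c : ℝ}
    (haz : a ≤ z) (hzb : z ≤ b) (ha : h a ≤ c) (hb : h b ≤ c) : h z ≤ c :=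
  (hh.le_max_of_mem_Icc (mem_univ a) (mem_univ b) ⟨haz, hzb⟩).trans (max_le ha hb)

/-- A recursive estimate with survival probabilities `lam j ≤ (j / (j + 1)) ^ r'` bounds any
quantity of growth `j ^ r`, `r < r'`, by the contributions lost on the way. -/
theorem le_of_staircase_recursion {G lam : ℕ → ℝ} {r r' c A : ℝ} {j₀ : ℕ} (hj₀ : 1 ≤ j₀)
    (hr : 0 < r) (hrr' : r < r') (hr'1 : r' ≤ r + 1) (hc : 0 ≤ c) (hA : 0 ≤ A)
    (hlam0 : ∀ j ≥ j₀, 0 ≤ lam j)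
    (hlam : ∀ j ≥ j₀, lam j ≤ ((j : ℝ) / (j + 1)) ^ r')
    (hlam1 : ∀ j ≥ j₀, 1 - lam j ≤ c / (j + 1))
    (hrec : ∀ j ≥ j₀, G j ≤ (1 - lam j) * (A * ((j : ℝ) + 1) ^ r) + lam j * G (j + 1))
    (hgrow : ∃ B, ∀ j ≥ j₀, G j ≤ B * (j : ℝ) ^ r) :
    G j₀ ≤ c * A * 2 ^ r / (r' - r) * (j₀ : ℝ) ^ r := by
  set δ := r' - r with hδ
  have hδ0 : 0 < δ := sub_pos.2 hrr'
  set B₀ := c * A * 2 ^ r / δ with hB₀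
  have hB₀0 : 0 ≤ B₀ := by positivity
  have hBδ : B₀ * δ = c * A * 2 ^ r := by rw [hB₀]; field_simp
  -- The power `B₀ * j ^ r` is a supersolution of the recursion: `B₀ * δ = c * A * 2 ^ r` makes the
  -- Bernoulli gain pay for the mass lost in one step.
  have key : ∀ j ≥ j₀, G j - B₀ * (j : ℝ) ^ r ≤
      lam j * (G (j + 1) - B₀ * ((j : ℝ) + 1) ^ r) := by
    intro j hj
    have hj1 : (1 : ℝ) ≤ j := by exact_mod_cast hj₀.trans hj
    have hjp : (0 : ℝ) < j := by linarith
    have h1 : (1 - lam j) * (A * ((j : ℝ) + 1) ^ r) ≤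
        c / (j + 1) * (A * (2 ^ r * (j : ℝ) ^ r)) := by
      rw [← Real.mul_rpow (by norm_num) hjp.le]
      refine mul_le_mul (hlam1 j hj) ?_ (by positivity) (by positivity)
      gcongr
      linarith
    have hq : (j : ℝ) / (j + 1) = 1 + -(1 / ((j : ℝ) + 1)) := by field_simp; ring
    have h2 : ((j : ℝ) / (j + 1)) ^ r' * ((j : ℝ) + 1) ^ r ≤
        (j : ℝ) ^ r * (1 - δ * (1 / ((j : ℝ) + 1))) := by
      have e1 : ((j : ℝ) / (j + 1)) ^ r' * ((j : ℝ) + 1) ^ r =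
          (j : ℝ) ^ r * ((j : ℝ) / (j + 1)) ^ δ := by
        have : r' = r + δ := by rw [hδ]; ring
        rw [this, Real.rpow_add (by positivity), Real.div_rpow hjp.le (by positivity) r]
        have : ((j : ℝ) + 1) ^ r ≠ 0 := (Real.rpow_pos_of_pos (by positivity) _).ne'
        field_simp
      rw [e1]
      gcongr
      have hs : (-1 : ℝ) ≤ -(1 / ((j : ℝ) + 1)) := by
        have : 1 / ((j : ℝ) + 1) ≤ 1 := by
          rw [div_le_one (by positivity)]; linarith
        linarith
      -- Bernoulli's inequality for an exponent `δ ≤ 1`; this is where `r' ≤ r + 1` enters.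
      have := rpow_one_add_le_one_add_mul_self hs hδ0.le (by linarith)
      rw [hq]
      linarith
    have h3 : lam j * (B₀ * ((j : ℝ) + 1) ^ r) ≤
        B₀ * ((j : ℝ) ^ r * (1 - δ * (1 / ((j : ℝ) + 1)))) := by
      calc lam j * (B₀ * ((j : ℝ) + 1) ^ r) = B₀ * (lam j * ((j : ℝ) + 1) ^ r) := by ring
        _ ≤ B₀ * (((j : ℝ) / (j + 1)) ^ r' * ((j : ℝ) + 1) ^ r) := by
          gcongr
          exact hlam j hj
        _ ≤ _ := by gcongr
    have h4 : c / ((j : ℝ) + 1) * (A * (2 ^ r * (j : ℝ) ^ r)) =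
        B₀ * δ * (1 / ((j : ℝ) + 1)) * (j : ℝ) ^ r := by
      rw [hBδ]; ring
    have := hrec j hj
    nlinarith [this, h1, h3, h4]
  -- Normalised by `j ^ r'`, the positive excess over the supersolution is nondecreasing in `j`, yet
  -- it is `O(j ^ (r - r'))`; hence it vanishes.
  set e : ℕ → ℝ := fun j => max (G j - B₀ * (j : ℝ) ^ r) 0 / (j : ℝ) ^ r' with he
  have hmono : ∀ j ≥ j₀, e j ≤ e (j + 1) := by
    intro j hj
    have hjp : (0 : ℝ) < j := by exact_mod_cast hj₀.trans hj
    have h1 : max (G j - B₀ * (j : ℝ) ^ r) 0 ≤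
        ((j : ℝ) / (j + 1)) ^ r' * max (G (j + 1) - B₀ * ((j : ℝ) + 1) ^ r) 0 := by
      refine max_le ((key j hj).trans ?_) (by positivity)
      refine (mul_le_mul_of_nonneg_left (le_max_left _ 0) (hlam0 j hj)).trans ?_
      exact mul_le_mul_of_nonneg_right (hlam j hj) (le_max_right _ _)
    simp only [he]
    push_cast
    rw [Real.div_rpow hjp.le (by positivity)] at h1
    rw [div_le_iff₀ (by positivity)]
    refine h1.trans (le_of_eq ?_)
    ring
  have hle : ∀ n ≥ j₀, e j₀ ≤ e n := fun n hn =>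
    Nat.le_induction le_rfl (fun k hk ih => ih.trans (hmono k hk)) n hn
  obtain ⟨B, hB⟩ := hgrow
  have hup : ∀ n ≥ j₀, e n ≤ max B 0 * (n : ℝ) ^ (-δ) := by
    intro n hn
    have hnp : (0 : ℝ) < n := by exact_mod_cast hj₀.trans hn
    simp only [he]
    rw [div_le_iff₀ (by positivity), mul_assoc, ← Real.rpow_add hnp]
    have : -δ + r' = r := by rw [hδ]; ring
    rw [this]
    refine max_le ?_ (by positivity)
    have h1 : B * (n : ℝ) ^ r ≤ max B 0 * (n : ℝ) ^ r := by gcongr; exact le_max_left _ _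
    have h2 : 0 ≤ B₀ * (n : ℝ) ^ r := by positivity
    linarith [hB n hn]
  have hlim : Tendsto (fun n : ℕ => max B 0 * (n : ℝ) ^ (-δ)) atTop (𝓝 0) := by
    simpa using ((tendsto_rpow_neg_atTop hδ0).comp tendsto_natCast_atTop_atTop).const_mul (max B 0)
  have he0 : e j₀ ≤ 0 := ge_of_tendsto hlim
    (eventually_atTop.2 ⟨j₀, fun n hn => (hle n hn).trans (hup n hn)⟩)
  have hjp : (0 : ℝ) < j₀ := by exact_mod_cast hj₀
  have : max (G j₀ - B₀ * (j₀ : ℝ) ^ r) 0 ≤ 0 := by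
    simp only [he] at he0
    rwa [div_le_iff₀ (by positivity), zero_mul] at he0
  linarith [le_max_left (G j₀ - B₀ * (j₀ : ℝ) ^ r) 0]

/-- The fraction of mass that survives one horizontal and one vertical step of the staircase. -/
noncomputable def survival (M m β L : ℝ) (j : ℝ) : ℝ :=
  ((β + 2 * j) + (β + 2 * L * j)) / ((β + 2 * j) + (β + 2 * L * (j + 1))) *
    ((m * (β + 2 * L * (j + 1)) + M * (β + 2 * j)) /
      (m * (β + 2 * L * (j + 1)) + M * (β + 2 * (j + 1))))

/-- Both factors have the form `1 - y ≤ exp (-y)`, and `j` times the two values of `y` tends to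
`L/(1+L)` and `M/(M+mL)`. The strict inequality on `r'` absorbs the lower-order terms, and `exp
(-r'/j) ≤ (j/(j+1)) ^ r'`. -/
theorem survival_le_rpow {M m β L r' : ℝ} (hM : 0 < M) (hm : 0 < m) (hβ : 0 ≤ β) (hL : 0 < L)
    (hr'0 : 0 ≤ r') (hr' : r' < L / (1 + L) + M / (M + m * L)) :
    ∀ᶠ j : ℕ in atTop, survival M m β L j ≤ ((j : ℝ) / (j + 1)) ^ r' := by
  have hlim : Tendsto (fun t : ℝ => L / (β * t + L * t + (1 + L)) +
      M / ((m * β + 2 * m * L + M * β + 2 * M) / 2 * t + (M + m * L))) (𝓝 0)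
      (𝓝 (L / (β * 0 + L * 0 + (1 + L)) +
      M / ((m * β + 2 * m * L + M * β + 2 * M) / 2 * 0 + (M + m * L)))) := by
    refine ContinuousAt.tendsto (f := fun t : ℝ => L / (β * t + L * t + (1 + L)) +
      M / ((m * β + 2 * m * L + M * β + 2 * M) / 2 * t + (M + m * L))) ?_
    refine ContinuousAt.add (ContinuousAt.div (by fun_prop) (by fun_prop) ?_)
      (ContinuousAt.div (by fun_prop) (by fun_prop) ?_)
    · simp; positivity
    · simp; positivity
  have hinv : Tendsto (fun j : ℕ => 1 / (j : ℝ)) atTop (𝓝 0) := tendsto_one_div_atTop_nhds_zero_nat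
  have hev := (hlim.comp hinv).eventually (lt_mem_nhds (by simpa using hr'))
  filter_upwards [hev, eventually_ge_atTop 1] with j hj hj1
  have hjp : (0 : ℝ) < j := by exact_mod_cast hj1
  simp only [Function.comp] at hj
  have h1 : ((β + 2 * j) + (β + 2 * L * j)) / ((β + 2 * j) + (β + 2 * L * (j + 1))) ≤
      Real.exp (-(2 * L / ((β + 2 * j) + (β + 2 * L * (j + 1))))) := by
    refine le_trans (le_of_eq ?_) (Real.one_sub_le_exp_neg _)
    have : (β + 2 * j) + (β + 2 * L * (j + 1)) ≠ 0 := by positivity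
    field_simp
    ring
  have h2 : (m * (β + 2 * L * (j + 1)) + M * (β + 2 * j)) /
      (m * (β + 2 * L * (j + 1)) + M * (β + 2 * (j + 1))) ≤
      Real.exp (-(2 * M / (m * (β + 2 * L * (j + 1)) + M * (β + 2 * (j + 1))))) := by
    refine le_trans (le_of_eq ?_) (Real.one_sub_le_exp_neg _)
    have : m * (β + 2 * L * (j + 1)) + M * (β + 2 * (j + 1)) ≠ 0 := by positivity
    field_simp
    ring
  have h3 : Real.exp (-(r' / j)) ≤ ((j : ℝ) / (j + 1)) ^ r' := by
    have hpos : (0 : ℝ) < (j : ℝ) / (j + 1) := by positivity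
    rw [Real.rpow_def_of_pos hpos]
    apply Real.exp_le_exp.2
    have hlog : Real.log ((j : ℝ) / (j + 1)) = -Real.log (1 + 1 / j) := by
      rw [← Real.log_inv]; congr 1; field_simp
    have hlog2 := Real.log_le_sub_one_of_pos (show (0 : ℝ) < 1 + 1 / j by positivity)
    rw [hlog]
    have : Real.log (1 + 1 / (j : ℝ)) * r' ≤ (1 / j) * r' := by gcongr; linarith
    rw [div_eq_mul_one_div]
    linarith
  refine le_trans ?_ h3
  refine (mul_le_mul h1 h2 (by positivity) (by positivity)).trans ?_
  rw [← Real.exp_add]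
  apply Real.exp_le_exp.2
  have e1 : 2 * L / ((β + 2 * j) + (β + 2 * L * (j + 1))) =
      (L / (β * (1 / j) + L * (1 / j) + (1 + L))) / j := by
    have : (β + 2 * j) + (β + 2 * L * (j + 1)) ≠ 0 := by positivity
    have : β * (1 / j) + L * (1 / j) + (1 + L) ≠ 0 := by positivity
    field_simp
    ring
  have e2 : 2 * M / (m * (β + 2 * L * (j + 1)) + M * (β + 2 * (j + 1))) =
      M / ((m * β + 2 * m * L + M * β + 2 * M) / 2 * (1 / j) + (M + m * L)) / j := by
    have : m * (β + 2 * L * (j + 1)) + M * (β + 2 * (j + 1)) ≠ 0 := by positivity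
    have : (m * β + 2 * m * L + M * β + 2 * M) / 2 * (1 / (j : ℝ)) + (M + m * L) ≠ 0 := by
      positivity
    field_simp
    ring
  rw [e1, e2, ← neg_add, ← add_div]
  apply neg_le_neg
  gcongr

theorem one_sub_survival_le {M m β L j : ℝ} (hM : 0 < M) (hm : 0 < m) (hβ : 0 ≤ β) (hL : 0 < L)
    (hj : 0 ≤ j) : 1 - survival M m β L j ≤ 2 / (j + 1) := by
  unfold survival
  set p := ((β + 2 * j) + (β + 2 * L * j)) / ((β + 2 * j) + (β + 2 * L * (j + 1))) with hp
  set q := (m * (β + 2 * L * (j + 1)) + M * (β + 2 * j)) /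
      (m * (β + 2 * L * (j + 1)) + M * (β + 2 * (j + 1))) with hq
  have hp1 : 1 - p ≤ 1 / (j + 1) := by
    rw [hp, one_sub_div (by positivity), div_le_div_iff₀ (by positivity) (by positivity)]
    nlinarith [mul_nonneg hL.le hj]
  have hq1 : 1 - q ≤ 1 / (j + 1) := by
    rw [hq, one_sub_div (by positivity), div_le_div_iff₀ (by positivity) (by positivity)]
    have : 0 ≤ m * (β + 2 * L * (j + 1)) := by positivity
    nlinarith [mul_nonneg hM.le hβ]
  have hp2 : p ≤ 1 := by
    rw [hp, div_le_one (by positivity)]; nlinarith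
  have hq2 : q ≤ 1 := by
    rw [hq, div_le_one (by positivity)]; nlinarith
  have : 2 / (j + 1) = 1 / (j + 1) + 1 / (j + 1) := by ring
  nlinarith [mul_nonneg (sub_nonneg.2 hp2) (sub_nonneg.2 hq2)]

set_option maxHeartbeats 800000 in
-- Iterating the two chords of the staircase expresses a corner through points of the graph, where
-- the `K` term vanishes. What matters is that `C` is chosen before `K`, `x₀` and `g`.
theorem le_on_staircase {a : ℝ → ℝ} {M m β r r' : ℝ} {L : ℕ} (hM1 : 1 ≤ M) (hM2 : M ≤ 2)
    (hm0 : 0 < m) (hβ0 : 0 ≤ β) (hβ2 : β ≤ 2) (hL : 0 < L) (hr : 1 < r)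
    (hrr' : r < r') (hr'1 : r' ≤ r + 1)
    (hr' : r' < L / (1 + L) + M / (M + m * L))
    (ha : ∀ x, |a x| ≤ 2 * |x|) (haM : ∀ n : ℕ, a (β + 2 * n) = M * (β + 2 * n))
    (ham : ∀ n : ℕ, a (-(β + 2 * n)) = -(m * (β + 2 * n))) :
    ∃ j₀ : ℕ, 1 ≤ j₀ ∧ ∃ C : ℝ, 0 ≤ C ∧ ∀ j : ℕ, j₀ ≤ j → ∀ x₀ : ℝ, |x₀| ≤ j → ∀ K : ℝ, 0 ≤ K →
      ∀ g : ℝ → ℝ → ℝ, SeparatelyConvex g →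
      (∀ x s, g x s ≤ K * (|a x - s| * (1 + |x| + |s|) ^ (r - 1)) + |x - x₀| ^ r) →
      g (-(β + 2 * L * j)) (M * (β + 2 * j)) ≤ C * (j : ℝ) ^ r := by
  have hM0 : 0 < M := by linarith
  have hLR : (0 : ℝ) < L := by exact_mod_cast hL
  have hL1 : (1 : ℝ) ≤ L := by exact_mod_cast hL
  obtain ⟨j₁, hj₁⟩ := eventually_atTop.1
    (survival_le_rpow hM0 hm0 hβ0 hLR (by linarith : 0 ≤ r') hr')
  -- With `|x₀| ≤ i` and `β ≤ 2`, both graph points used at stage `i` lie within `(3 + 2L)(i + 1)`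
  -- of `x₀` horizontally.
  set A : ℝ := (3 + 2 * L) ^ r with hA
  refine ⟨max j₁ 1, le_max_right _ _, 2 * A * 2 ^ r / (r' - r), ?_, ?_⟩
  · have : 0 < r' - r := sub_pos.2 hrr'
    positivity
  intro j hj x₀ hx₀ K hK g hg hgle
  have hjone : 1 ≤ j := (le_max_right _ _).trans hj
  refine le_of_staircase_recursion (G := fun j : ℕ => g (-(β + 2 * L * j)) (M * (β + 2 * j)))
    (lam := fun j : ℕ => survival M m β L j) hjone (by linarith) hrr' hr'1 (by norm_num)
    (by positivity) ?_ ?_ ?_ ?_ ?_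
  · intro i _
    unfold survival
    positivity
  · exact fun i hi => hj₁ i ((le_max_left _ _).trans (hj.trans hi))
  · exact fun i _ => one_sub_survival_le hM0 hm0 hβ0 hLR (Nat.cast_nonneg i)
  · intro i hi
    have hi0 : (0 : ℝ) ≤ i := Nat.cast_nonneg i
    have hij : |x₀| ≤ i := hx₀.trans (by exact_mod_cast hi)
    have hx₀' := abs_le.1 hij
    -- The corner `(-X, M b)` lies on the horizontal chord from the graph point `(b, M b)` to `(-X',
    -- M b)`. The latter lies on the vertical chord from the graph point `(-X', -m X')` to the next
    -- corner.
    set b := β + 2 * (i : ℝ) with hb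
    set X := β + 2 * L * (i : ℝ) with hX
    set X' := β + 2 * L * ((i : ℝ) + 1) with hX'
    have hb0 : 0 ≤ b := by positivity
    have hX0 : 0 ≤ X := by positivity
    have hXX : X < X' := by rw [hX, hX']; nlinarith
    have hX'0 : 0 < X' := by linarith
    have hAi : ((3 + 2 * (L : ℝ)) * (i + 1)) ^ r = A * ((i : ℝ) + 1) ^ r := by
      rw [Real.mul_rpow (by positivity) (by positivity)]
    have good1 : g b (M * b) ≤ A * ((i : ℝ) + 1) ^ r := by
      have h := hgle b (M * b)
      rw [haM i] at h
      simp only [← hb, sub_self, abs_zero, zero_mul, mul_zero, zero_add] at h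
      refine h.trans ?_
      rw [← hAi]
      refine Real.rpow_le_rpow (abs_nonneg _) (abs_le.2 ⟨?_, ?_⟩) (by linarith)
      · nlinarith
      · nlinarith
    have good2 : g (-X') (-(m * X')) ≤ A * ((i : ℝ) + 1) ^ r := by
      have h := hgle (-X') (-(m * X'))
      have h2 := ham (L * (i + 1))
      push_cast at h2
      rw [show β + 2 * ((L : ℝ) * (i + 1)) = X' by rw [hX']; ring] at h2
      rw [h2] at h
      simp only [sub_self, abs_zero, zero_mul, mul_zero, zero_add] at h
      refine h.trans ?_
      rw [← hAi]
      refine Real.rpow_le_rpow (abs_nonneg _) (abs_le.2 ⟨?_, ?_⟩) (by linarith)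
      · rw [hX']; nlinarith
      · nlinarith
    set p := (b + X) / (b + X') with hp
    set q := (m * X' + M * b) / (m * X' + M * (β + 2 * ((i : ℝ) + 1))) with hq
    have hsurv : survival M m β L i = p * q := rfl
    have hp0 : 0 ≤ p := by positivity
    have hq0 : 0 ≤ q := by positivity
    have hbX : 0 < b + X' := by linarith
    have hd : 0 < m * X' + M * (β + 2 * ((i : ℝ) + 1)) := by positivity
    have hp1 : p ≤ 1 := by rw [hp, div_le_one hbX]; linarith
    have hq1 : q ≤ 1 := by rw [hq, div_le_one hd, hb]; nlinarith
    have s1 : g (-X) (M * b) ≤ (1 - p) * g b (M * b) + p * g (-X') (M * b) := by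
      refine (hg.1 (M * b)).le_combination hp0 hp1 ?_
      rw [hp]; field_simp; ring
    have s2 : g (-X') (M * b) ≤ (1 - q) * g (-X') (-(m * X')) +
        q * g (-X') (M * (β + 2 * ((i : ℝ) + 1))) := by
      refine (hg.2 (-X')).le_combination hq0 hq1 ?_
      rw [hq]; field_simp; rw [hb]; ring
    simp only [hsurv]
    push_cast
    calc g (-X) (M * b) ≤ (1 - p) * g b (M * b) + p * g (-X') (M * b) := s1
      _ ≤ (1 - p) * (A * ((i : ℝ) + 1) ^ r) + p * ((1 - q) * (A * ((i : ℝ) + 1) ^ r) +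
        q * g (-X') (M * (β + 2 * ((i : ℝ) + 1)))) := by
        refine add_le_add (mul_le_mul_of_nonneg_left good1 (sub_nonneg.2 hp1))
          (mul_le_mul_of_nonneg_left (s2.trans ?_) hp0)
        gcongr
      _ = _ := by ring
  -- The growth bound may depend on `K`: the recursion uses only its exponent `r`.
  · refine ⟨K * ((2 * (2 + 2 * L) + 8) * (1 + (2 + 2 * L) + 8) ^ (r - 1)) +
      (3 + 2 * (L : ℝ)) ^ r, fun i hi => ?_⟩
    have hi1 : (1 : ℝ) ≤ i := by exact_mod_cast hjone.trans hi
    have hip : (0 : ℝ) < i := by linarith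
    have hij : |x₀| ≤ i := hx₀.trans (by exact_mod_cast hi)
    have hx₀' := abs_le.1 hij
    refine (hgle _ _).trans ?_
    rw [add_mul, mul_assoc K]
    have hXle : |-(β + 2 * L * (i : ℝ))| ≤ (2 + 2 * L) * i := by
      rw [abs_neg, abs_of_nonneg (by positivity)]; nlinarith
    have hSle : |M * (β + 2 * (i : ℝ))| ≤ 8 * i := by
      rw [abs_of_nonneg (by positivity)]
      calc M * (β + 2 * (i : ℝ)) ≤ 2 * (4 * i) :=
            mul_le_mul hM2 (by linarith) (by positivity) (by norm_num)
        _ = 8 * i := by ring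
    refine add_le_add ?_ ?_
    · refine mul_le_mul_of_nonneg_left ?_ hK
      have e : ((i : ℝ)) ^ r = i * (i : ℝ) ^ (r - 1) := by
        rw [Real.rpow_sub_one hip.ne']; field_simp
      calc _ ≤ ((2 * (2 + 2 * L) + 8) * (i : ℝ)) * ((1 + (2 + 2 * L) + 8) * (i : ℝ)) ^ (r - 1) := by
            refine mul_le_mul ?_ ?_ (by positivity) (by positivity)
            · refine (abs_sub _ _).trans ?_
              linarith [ha (-(β + 2 * L * (i : ℝ)))]
            · refine Real.rpow_le_rpow (by positivity) ?_ (by linarith)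
              linarith
        _ = _ := by
            rw [Real.mul_rpow (by positivity) hip.le, e]; ring
    · rw [← Real.mul_rpow (by positivity) hip.le]
      refine Real.rpow_le_rpow (abs_nonneg _) ?_ (by linarith)
      refine (abs_sub _ _).trans ?_
      linarith

/-- Split `(x₀, s₀)` vertically between the graph point above `x₀`, where `g ≤ 0`, and a point at
staircase height `S` of order `R = 1 + |x₀| + |s₀|`. The weight of the high point is at most `(s₀ -
a x₀) / R` and `g` there is `O(R ^ r)`, which produces the weighted deviation. -/
theorem le_of_above_graph {a : ℝ → ℝ} {M m β r r' : ℝ} {L : ℕ} (hM1 : 1 ≤ M) (hM2 : M ≤ 2)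
    (hm0 : 0 < m) (hβ0 : 0 ≤ β) (hβ2 : β ≤ 2) (hL : 0 < L) (hr : 1 < r)
    (hrr' : r < r') (hr'1 : r' ≤ r + 1)
    (hr' : r' < L / (1 + L) + M / (M + m * L))
    (ha : ∀ x, |a x| ≤ 2 * |x|) (haM : ∀ n : ℕ, a (β + 2 * n) = M * (β + 2 * n))
    (ham : ∀ n : ℕ, a (-(β + 2 * n)) = -(m * (β + 2 * n))) :
    ∃ C : ℝ, 0 ≤ C ∧ ∀ x₀ s₀ : ℝ, a x₀ ≤ s₀ → ∀ K : ℝ, 0 ≤ K →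
      ∀ g : ℝ → ℝ → ℝ, SeparatelyConvex g →
      (∀ x s, g x s ≤ K * (|a x - s| * (1 + |x| + |s|) ^ (r - 1)) + |x - x₀| ^ r) →
      g x₀ s₀ ≤ C * (|a x₀ - s₀| * (1 + |x₀| + |s₀|) ^ (r - 1)) := by
  obtain ⟨j₀, hj₀, C, hC, hstair⟩ := le_on_staircase hM1 hM2 hm0 hβ0 hβ2 hL hr hrr' hr'1 hr'
    ha haM ham
  refine ⟨(C + 5 ^ r) * (5 + j₀) ^ r, by positivity, ?_⟩
  intro x₀ s₀ has K hK g hg hgle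
  have hL1 : (1 : ℝ) ≤ L := by exact_mod_cast hL
  set R := 1 + |x₀| + |s₀| with hR
  have hx0 := abs_nonneg x₀
  have hs0 := abs_nonneg s₀
  have hR1 : 1 ≤ R := by linarith
  have hR0 : 0 < R := by linarith
  -- The factor `4` gives `S ≥ 8 R`, well above both `s₀` and `a x₀ ≤ 2 R`; adding `j₀` puts `j` in
  -- the range of the staircase estimate.
  set j := ⌈4 * R⌉₊ + j₀ with hj
  have hj4 : 4 * R ≤ j := by
    rw [hj]; push_cast; linarith [Nat.le_ceil (4 * R), (Nat.cast_nonneg j₀ : (0 : ℝ) ≤ j₀)]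
  have hjle : (j : ℝ) ≤ (5 + j₀) * R := by
    rw [hj]; push_cast
    nlinarith [Nat.ceil_lt_add_one (show 0 ≤ 4 * R by linarith), (Nat.cast_nonneg j₀ : (0 : ℝ) ≤ j₀)]
  have hxj : |x₀| ≤ j := by linarith
  have hx := abs_le.1 hxj
  have hjp : (0 : ℝ) < j := by linarith
  set S := M * (β + 2 * (j : ℝ)) with hS
  have hS8 : 8 * R ≤ S := by rw [hS]; nlinarith
  have haxR : a x₀ ≤ 2 * R := by
    have := (le_abs_self _).trans (ha x₀); linarith
  have hsS : s₀ ≤ S := by linarith [le_abs_self s₀]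
  have hSa : R ≤ S - a x₀ := by linarith
  have hleft : g (-(β + 2 * L * (j : ℝ))) S ≤ (C + 5 ^ r) * (j : ℝ) ^ r := by
    have h := hstair j (Nat.le_add_left _ _) x₀ hxj K hK g hg hgle
    have : 0 ≤ (5 : ℝ) ^ r * (j : ℝ) ^ r := by positivity
    linarith
  have hright : g (β + 2 * (j : ℝ)) S ≤ (C + 5 ^ r) * (j : ℝ) ^ r := by
    have h := hgle (β + 2 * (j : ℝ)) S
    rw [haM j] at h
    simp only [← hS, sub_self, abs_zero, zero_mul, mul_zero, zero_add] at h
    have h5 : |β + 2 * (j : ℝ) - x₀| ^ r ≤ (5 : ℝ) ^ r * (j : ℝ) ^ r := by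
      rw [← Real.mul_rpow (by norm_num) hjp.le]
      refine Real.rpow_le_rpow (abs_nonneg _) (abs_le.2 ⟨?_, ?_⟩) (by linarith) <;> linarith
    have : 0 ≤ C * (j : ℝ) ^ r := by positivity
    linarith
  -- At height `S`, the abscissa `x₀` lies between a staircase corner on the left and a graph point
  -- on the right.
  have htop : g x₀ S ≤ (C + 5 ^ r) * (j : ℝ) ^ r := by
    refine (hg.1 S).le_max_of_between (a := -(β + 2 * L * (j : ℝ))) (b := β + 2 * (j : ℝ))
      ?_ ?_ hleft hright
    · nlinarith
    · linarith
  have hgraph : g x₀ (a x₀) ≤ 0 := by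
    have h := hgle x₀ (a x₀)
    simpa [Real.zero_rpow (show r ≠ 0 by linarith)] using h
  set μ := (s₀ - a x₀) / (S - a x₀) with hμ
  have hSa0 : 0 < S - a x₀ := by linarith
  have hμ0 : 0 ≤ μ := div_nonneg (sub_nonneg.2 has) hSa0.le
  have hμ1 : μ ≤ 1 := by rw [hμ, div_le_one hSa0]; linarith
  have hsplit : g x₀ s₀ ≤ (1 - μ) * g x₀ (a x₀) + μ * g x₀ S := by
    refine (hg.2 x₀).le_combination hμ0 hμ1 ?_
    rw [hμ]; field_simp; ring
  have hμR : μ ≤ (s₀ - a x₀) / R := by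
    rw [hμ]
    exact div_le_div_of_nonneg_left (sub_nonneg.2 has) hR0 hSa
  have hjr : (j : ℝ) ^ r ≤ (5 + j₀) ^ r * R ^ r := by
    rw [← Real.mul_rpow (by positivity) hR0.le]
    exact Real.rpow_le_rpow hjp.le hjle (by linarith)
  have habs : |a x₀ - s₀| = s₀ - a x₀ := by rw [abs_sub_comm, abs_of_nonneg (sub_nonneg.2 has)]
  rw [habs]
  calc g x₀ s₀ ≤ (1 - μ) * g x₀ (a x₀) + μ * g x₀ S := hsplit
    _ ≤ 0 + ((s₀ - a x₀) / R) * ((C + 5 ^ r) * ((5 + j₀) ^ r * R ^ r)) := by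
      refine add_le_add (mul_nonpos_of_nonneg_of_nonpos (sub_nonneg.2 hμ1) hgraph) ?_
      refine (mul_le_mul_of_nonneg_left htop hμ0).trans ?_
      refine mul_le_mul hμR (by gcongr) (by positivity) (div_nonneg (sub_nonneg.2 has) hR0.le)
    _ = _ := by
      rw [Real.rpow_sub_one hR0.ne']; field_simp; ring

/-! ### The oscillating nonlinearity and its scalar envelope. -/

/-- The scalar nonlinearity `x ↦ (1 + κ sin (π x)) x`; `fieldA θ` acts by `wave (√θ)` on each
coordinate. -/
noncomputable def wave (κ x : ℝ) : ℝ := (1 + κ * Real.sin (Real.pi * x)) * x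

theorem abs_wave_le {κ : ℝ} (hκ : |κ| ≤ 1) (x : ℝ) : |wave κ x| ≤ 2 * |x| := by
  rw [wave, abs_mul]
  refine mul_le_mul_of_nonneg_right ?_ (abs_nonneg x)
  refine (abs_add_le _ _).trans ?_
  rw [abs_mul, abs_one]
  nlinarith [Real.abs_sin_le_one (Real.pi * x), abs_nonneg κ, abs_nonneg (Real.sin (Real.pi * x))]

theorem wave_neg (κ x : ℝ) : wave κ (-x) = -wave (-κ) x := by
  simp only [wave, mul_neg, Real.sin_neg]; ring

theorem sin_pi_mul_half_add (n : ℕ) : Real.sin (Real.pi * (1 / 2 + 2 * n)) = 1 := by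
  rw [show Real.pi * (1 / 2 + 2 * n) = Real.pi / 2 + n * (2 * Real.pi) by ring,
    Real.sin_add_nat_mul_two_pi, Real.sin_pi_div_two]

theorem sin_pi_mul_three_half_add (n : ℕ) : Real.sin (Real.pi * (3 / 2 + 2 * n)) = -1 := by
  rw [show Real.pi * (3 / 2 + 2 * n) = (Real.pi / 2 + Real.pi) + n * (2 * Real.pi) by ring,
    Real.sin_add_nat_mul_two_pi, Real.sin_add_pi, Real.sin_pi_div_two]

/-- The deviation of `(x, s)` from the graph of `wave κ`, weighted so that it has growth `r`. -/
noncomputable def defect (κ r x s : ℝ) : ℝ := |wave κ x - s| * (1 + |x| + |s|) ^ (r - 1)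

/-- Above the graph the staircase uses `β = 1/2`, where the sine is `1` on the right and `-1` on the
left. Point reflection turns points below the graph into points above that of `wave (-κ)`, for which
`β = 3/2` plays the same role. -/
theorem separatelyConvex_envelope_le {κ r : ℝ} {L : ℕ} (hκ0 : 0 < κ) (hκ1 : κ < 1) (hL : 0 < L)
    (hr : 1 < r) (hrL : r < L / (1 + L) + (1 + κ) / ((1 + κ) + (1 - κ) * L)) :
    ∃ C : ℝ, 0 ≤ C ∧ ∀ x₀ s₀ : ℝ, ∀ K : ℝ, 0 ≤ K → ∀ g : ℝ → ℝ → ℝ, SeparatelyConvex g →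
      (∀ x s, g x s ≤ K * defect κ r x s + |x - x₀| ^ r) → g x₀ s₀ ≤ C * defect κ r x₀ s₀ := by
  obtain ⟨r₁, hr₁, hr₁'⟩ := exists_between hrL
  set r' := min r₁ (r + 1)
  have hrr' : r < r' := lt_min hr₁ (by linarith)
  have hr'1 : r' ≤ r + 1 := min_le_right _ _
  have hr'L := (min_le_left r₁ (r + 1)).trans_lt hr₁'
  have habs : |κ| ≤ 1 := abs_le.2 ⟨by linarith, by linarith⟩
  obtain ⟨C₁, hC₁, h₁⟩ := le_of_above_graph (a := wave κ) (β := 1 / 2) (m := 1 - κ) (by linarith)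
    (by linarith) (by linarith) (by norm_num) (by norm_num) hL hr hrr' hr'1 hr'L
    (abs_wave_le habs) (fun n => by simp only [wave, sin_pi_mul_half_add]; ring)
    (fun n => by rw [wave_neg]; simp only [wave, sin_pi_mul_half_add]; ring)
  obtain ⟨C₂, hC₂, h₂⟩ := le_of_above_graph (a := wave (-κ)) (β := 3 / 2) (m := 1 - κ)
    (by linarith) (by linarith) (by linarith) (by norm_num) (by norm_num) hL hr hrr'
    hr'1 hr'L (abs_wave_le (by rwa [abs_neg]))
    (fun n => by simp only [wave, sin_pi_mul_three_half_add]; ring)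
    (fun n => by rw [wave_neg]; simp only [wave, sin_pi_mul_three_half_add]; ring)
  refine ⟨C₁ + C₂, by positivity, fun x₀ s₀ K hK g hg hgle => ?_⟩
  have hd : 0 ≤ defect κ r x₀ s₀ := by unfold defect; positivity
  rcases le_total (wave κ x₀) s₀ with h | h
  · have := h₁ x₀ s₀ h K hK g hg hgle
    rw [← defect] at this
    nlinarith
  · have hdef : ∀ x s, defect κ r (-x) (-s) =
        |wave (-κ) x - s| * (1 + |x| + |s|) ^ (r - 1) := fun x s => by
      rw [defect, wave_neg, abs_neg, abs_neg, show -wave (-κ) x - -s = -(wave (-κ) x - s) by ring,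
        abs_neg]
    have hg' : SeparatelyConvex fun x s => g (-x) (-s) := by
      refine ⟨fun s => ?_, fun x => ?_⟩
      · exact (hg.1 (-s)).comp_linearMap (-LinearMap.id)
      · exact (hg.2 (-x)).comp_linearMap (-LinearMap.id)
    have := h₂ (-x₀) (-s₀) (by rw [wave_neg, neg_neg]; linarith) K hK
      (fun x s => g (-x) (-s)) hg' (fun x s => by
        have h := hgle (-x) (-s)
        rw [hdef] at h
        rwa [show -x - x₀ = -(x - -x₀) by ring, abs_neg] at h)
    rw [← hdef] at this
    simp only [neg_neg] at this
    nlinarith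

/-- The staircase exponent dominates the one in `qBar`, since `(1 - √θ)/(1 + √θ) ≤ (1 - √θ)(1 + √θ)
= 1 - θ`. -/
theorem exists_step_of_lt_qBar {θ r : ℝ} (hθ0 : 0 < θ) (hθ1 : θ < 1) (hr : r < qBar θ) :
    ∃ L : ℕ, 0 < L ∧ r < L / (1 + L) + (1 + √θ) / ((1 + √θ) + (1 - √θ) * L) := by
  have hne : {q : ℝ | ∃ L : ℕ, 0 < L ∧ Even L ∧
      q = 1 - 1 / (1 + (L : ℝ)) + 1 / (1 + (L : ℝ) * (1 - θ))}.Nonempty :=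
    ⟨_, 2, by norm_num, even_two, rfl⟩
  obtain ⟨q, ⟨L, hL, -, rfl⟩, hrq⟩ := exists_lt_of_lt_csSup hne hr
  refine ⟨L, hL, hrq.trans_le ?_⟩
  have hLR : (0 : ℝ) < L := by exact_mod_cast hL
  have hs0 : 0 < √θ := Real.sqrt_pos.2 hθ0
  have hs1 : √θ < 1 := by rw [Real.sqrt_lt' one_pos]; simpa using hθ1
  have hsq : √θ * √θ = θ := Real.mul_self_sqrt hθ0.le
  have e1 : 1 - 1 / (1 + (L : ℝ)) = L / (1 + L) := by field_simp; ring
  rw [e1]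
  refine add_le_add le_rfl ?_
  have h1 : 0 < 1 - √θ := by linarith
  have h2 : 0 < 1 - θ := by linarith
  rw [div_le_div_iff₀ (by positivity) (by positivity)]
  have h3 : 1 - θ = (1 - √θ) * (1 + √θ) := by linear_combination hsq
  rw [h3]
  have h4 : 0 ≤ (1 - √θ) * L * (√θ * (2 + √θ)) := by positivity
  nlinarith

/-! ### Test maps on the unit square and its subdivision. -/

/-- The half-open unit square centred at the origin. -/
def cell : Set Plane := {x | ∀ i, x i ∈ Ico (-(1 / 2) : ℝ) (1 / 2)}

/-- The open unit square centred at the origin. -/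
def openCell : Set Plane := {x | ∀ i, x i ∈ Ioo (-(1 / 2) : ℝ) (1 / 2)}

theorem openCell_subset_cell : openCell ⊆ cell := fun _ hx i => Ioo_subset_Ico_self (hx i)

theorem isOpen_openCell : IsOpen openCell := by
  have : openCell = ⋂ i, (fun x : Plane => x i) ⁻¹' Ioo (-(1 / 2) : ℝ) (1 / 2) := by
    ext; simp [openCell]
  rw [this]
  exact isOpen_iInter_of_finite fun i => isOpen_Ioo.preimage (by fun_prop)

theorem measurableSet_cell : MeasurableSet cell := by
  have : cell = ⋂ i, (fun x : Plane => x i) ⁻¹' Ico (-(1 / 2) : ℝ) (1 / 2) := by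
    ext; simp [cell]
  rw [this]
  exact MeasurableSet.iInter fun i => measurableSet_Ico.preimage
    (Continuous.measurable (by fun_prop))

theorem norm_lt_one_of_mem_cell {x : Plane} (hx : x ∈ cell) : ‖x‖ < 1 := by
  rw [EuclideanSpace.norm_eq, Real.sqrt_lt' one_pos, Fin.sum_univ_two]
  have h0 := hx 0
  have h1 := hx 1
  simp only [Real.norm_eq_abs, sq_abs]
  nlinarith [h0.1, h0.2, h1.1, h1.2]

theorem cell_subset_closedBall : cell ⊆ Metric.closedBall (0 : Plane) 1 := fun _ hx => by
  simpa using (norm_lt_one_of_mem_cell hx).le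

theorem Continuous.integrableOn_cell {F : Type*} [NormedAddCommGroup F] {f : Plane → F}
    (hf : Continuous f) : IntegrableOn f cell :=
  (hf.continuousOn.integrableOn_compact (isCompact_closedBall 0 1)).mono_set cell_subset_closedBall

theorem volume_cell_lt_top : volume cell < ∞ :=
  (measure_mono cell_subset_closedBall).trans_lt (isCompact_closedBall 0 1).measure_lt_top

section CellTest

variable {V : Type*} [NormedAddCommGroup V] [NormedSpace ℝ V]

/-- Smooth maps with compact support in the open unit square. -/
structure IsCellTest (w : Plane → V) : Prop where
  contDiff : ContDiff ℝ (⊤ : ℕ∞) w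
  tsupport_subset : tsupport w ⊆ openCell

namespace IsCellTest

theorem hasCompactSupport {w : Plane → V} (hw : IsCellTest w) : HasCompactSupport w :=
  (isCompact_closedBall 0 1).of_isClosed_subset (isClosed_tsupport w)
    (hw.tsupport_subset.trans (openCell_subset_cell.trans cell_subset_closedBall))

theorem continuous_fderiv {w : Plane → V} (hw : IsCellTest w) : Continuous (fderiv ℝ w) :=
  hw.contDiff.continuous_fderiv (by simp)

theorem differentiable {w : Plane → V} (hw : IsCellTest w) : Differentiable ℝ w :=
  hw.contDiff.differentiable (by simp)

theorem eq_zero_of_notMem {w : Plane → V} (hw : IsCellTest w) {x : Plane} (hx : x ∉ cell) :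
    w x = 0 :=
  image_eq_zero_of_notMem_tsupport fun h => hx (openCell_subset_cell (hw.tsupport_subset h))

theorem fderiv_eq_zero_of_notMem {w : Plane → V} (hw : IsCellTest w) {x : Plane} (hx : x ∉ cell) :
    fderiv ℝ w x = 0 :=
  image_eq_zero_of_notMem_tsupport fun h =>
    hx (openCell_subset_cell (hw.tsupport_subset (tsupport_fderiv_subset ℝ h)))

theorem zero : IsCellTest (0 : Plane → V) :=
  ⟨contDiff_zero_fun, by simp [tsupport_zero]⟩

theorem add {w w' : Plane → V} (hw : IsCellTest w) (hw' : IsCellTest w') : IsCellTest (w + w') :=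
  ⟨hw.contDiff.add hw'.contDiff,
    (tsupport_add w w').trans (union_subset hw.tsupport_subset hw'.tsupport_subset)⟩

theorem sum {ι : Type*} (s : Finset ι) {w : ι → Plane → V} (hw : ∀ i ∈ s, IsCellTest (w i)) :
    IsCellTest (∑ i ∈ s, w i) :=
  Finset.sum_induction w IsCellTest (fun _ _ => add) zero hw

theorem exists_bound {w : Plane → V} (hw : IsCellTest w) : ∃ b, 0 ≤ b ∧ ∀ x, ‖w x‖ ≤ b := by
  obtain ⟨b, hb⟩ := hw.contDiff.continuous.bounded_above_of_compact_support hw.hasCompactSupport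
  exact ⟨b, (norm_nonneg _).trans (hb 0), hb⟩

end IsCellTest

end CellTest

/-- The homothety that maps the `k`-th square of the uniform subdivision of `cell` into `N ^ 2`
squares onto `cell`. -/
noncomputable def zoom (N : ℕ) (k : Fin 2 → Fin N) (x : Plane) : Plane :=
  (N : ℝ) • x - WithLp.toLp 2 fun i => ((k i : ℕ) : ℝ) + 1 / 2 - N / 2

theorem zoom_apply (N : ℕ) (k : Fin 2 → Fin N) (x : Plane) (i : Fin 2) :
    zoom N k x i = N * x i - (((k i : ℕ) : ℝ) + 1 / 2 - N / 2) := by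
  simp [zoom]

theorem continuous_zoom (N : ℕ) (k : Fin 2 → Fin N) : Continuous (zoom N k) := by
  unfold zoom; fun_prop

/-- The centre of the `k`-th square of the subdivision. -/
noncomputable def zoomCenter (N : ℕ) (k : Fin 2 → Fin N) : Plane :=
  (N : ℝ)⁻¹ • WithLp.toLp 2 fun i => ((k i : ℕ) : ℝ) + 1 / 2 - N / 2

theorem zoom_eq_smul_sub {N : ℕ} (hN : 0 < N) (k : Fin 2 → Fin N) (x : Plane) :
    zoom N k x = (N : ℝ) • (x - zoomCenter N k) := by
  have : (N : ℝ) ≠ 0 := by positivity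
  rw [zoom, zoomCenter, smul_sub, smul_inv_smul₀ this]

theorem zoom_zoomCenter {N : ℕ} (hN : 0 < N) (k : Fin 2 → Fin N) :
    zoom N k (zoomCenter N k) = 0 := by
  simp [zoom_eq_smul_sub hN]

theorem mem_cell_of_zoom_mem {N : ℕ} (hN : 0 < N) {k : Fin 2 → Fin N} {x : Plane}
    (hx : zoom N k x ∈ cell) : x ∈ cell := by
  intro i
  have h := hx i
  rw [zoom_apply] at h
  have hNp : (0 : ℝ) < N := by positivity
  have hk0 : (0 : ℝ) ≤ ((k i : ℕ) : ℝ) := Nat.cast_nonneg _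
  have hk1 : ((k i : ℕ) : ℝ) + 1 ≤ N := by exact_mod_cast (k i).2
  constructor
  · by_contra! hc
    nlinarith [h.1, h.2]
  · by_contra! hc
    nlinarith [h.1, h.2]

theorem mem_openCell_of_zoom_mem {N : ℕ} (hN : 0 < N) {k : Fin 2 → Fin N} {x : Plane}
    (hx : zoom N k x ∈ openCell) : x ∈ openCell := by
  intro i
  have h := hx i
  rw [zoom_apply] at h
  have hNp : (0 : ℝ) < N := by positivity
  have hk0 : (0 : ℝ) ≤ ((k i : ℕ) : ℝ) := Nat.cast_nonneg _
  have hk1 : ((k i : ℕ) : ℝ) + 1 ≤ N := by exact_mod_cast (k i).2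
  constructor
  · by_contra! hc
    nlinarith [h.1, h.2]
  · by_contra! hc
    nlinarith [h.1, h.2]

theorem eq_of_zoom_mem {N : ℕ} {k l : Fin 2 → Fin N} {x : Plane}
    (hk : zoom N k x ∈ cell) (hl : zoom N l x ∈ cell) : k = l := by
  ext i
  have h1 := hk i
  have h2 := hl i
  rw [zoom_apply] at h1 h2
  have a : ((k i : ℕ) : ℝ) < (l i : ℕ) + 1 := by linarith [h1.1, h2.2]
  have b : ((l i : ℕ) : ℝ) < (k i : ℕ) + 1 := by linarith [h1.2, h2.1]
  have a' : (k i : ℕ) < (l i : ℕ) + 1 := by exact_mod_cast a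
  have b' : (l i : ℕ) < (k i : ℕ) + 1 := by exact_mod_cast b
  omega

theorem exists_zoom_mem {N : ℕ} (hN : 0 < N) {x : Plane} (hx : x ∈ cell) :
    ∃ k, zoom N k x ∈ cell := by
  have hNp : (0 : ℝ) < N := by positivity
  have h0 : ∀ i, 0 ≤ (N : ℝ) * (x i + 1 / 2) := fun i =>
    mul_nonneg hNp.le (by linarith [(hx i).1])
  have hlt : ∀ i, ⌊(N : ℝ) * (x i + 1 / 2)⌋₊ < N := fun i => by
    rw [Nat.floor_lt (h0 i)]
    nlinarith [(hx i).2]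
  refine ⟨fun i => ⟨_, hlt i⟩, fun i => ?_⟩
  rw [zoom_apply]
  have h1 := Nat.floor_le (h0 i)
  have h2 := Nat.lt_floor_add_one ((N : ℝ) * (x i + 1 / 2))
  constructor <;> simp only <;> linarith

theorem cell_eq_iUnion {N : ℕ} (hN : 0 < N) : cell = ⋃ k, zoom N k ⁻¹' cell := by
  ext x
  simp only [mem_iUnion, mem_preimage]
  exact ⟨exists_zoom_mem hN, fun ⟨k, hk⟩ => mem_cell_of_zoom_mem hN hk⟩

theorem setIntegral_cell_eq_sum {N : ℕ} (hN : 0 < N) {f : Plane → ℝ} (hf : IntegrableOn f cell) :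
    ∫ x in cell, f x = ∑ k, ∫ x in zoom N k ⁻¹' cell, f x := by
  conv_lhs => rw [cell_eq_iUnion hN]
  refine integral_iUnion_fintype (fun k => measurableSet_cell.preimage
    (continuous_zoom N k).measurable) ?_ fun k => hf.mono_set fun x hx => mem_cell_of_zoom_mem hN hx
  intro k l hkl
  exact disjoint_left.2 fun x hk hl => hkl (eq_of_zoom_mem hk hl)

theorem setIntegral_zoom {N : ℕ} (hN : 0 < N) (k : Fin 2 → Fin N) (h : Plane → ℝ) :
    ∫ x in zoom N k ⁻¹' cell, h (zoom N k x) = ((N : ℝ) ^ 2)⁻¹ * ∫ x in cell, h x := by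
  rw [← integral_indicator (measurableSet_cell.preimage (continuous_zoom N k).measurable),
    ← integral_indicator measurableSet_cell]
  have : ∀ x, (zoom N k ⁻¹' cell).indicator (fun x => h (zoom N k x)) x =
      cell.indicator h ((N : ℝ) • (x - zoomCenter N k)) := fun x => by
    rw [← zoom_eq_smul_sub hN]; rfl
  simp_rw [this]
  rw [integral_sub_right_eq_self (fun x => cell.indicator h ((N : ℝ) • x)),
    Measure.integral_comp_smul]
  simp

theorem cell_eq_preimage : cell = WithLp.ofLp ⁻¹' (univ.pi fun _ => Ico (-(1 / 2) : ℝ) (1 / 2)) := by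
  ext x; simp [cell]

theorem volume_cell : volume cell = 1 := by
  rw [cell_eq_preimage, (PiLp.volume_preserving_ofLp (Fin 2)).measure_preimage
    (MeasurableSet.univ_pi fun _ => measurableSet_Ico).nullMeasurableSet, Real.volume_pi_Ico]
  norm_num

theorem setIntegral_cell_const (c : ℝ) : ∫ _ in cell, c = c := by
  simp [measureReal_def, volume_cell]

/-! ### Insertion of fine-scale perturbations. -/

section Refinement

variable {V : Type*} [NormedAddCommGroup V] [NormedSpace ℝ V]

/-- The prefactor `1 / N` keeps the values of the gradient unchanged under zooming and makes the map
itself uniformly small. -/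
theorem IsCellTest.rescale {w : Plane → V} (hw : IsCellTest w) {N : ℕ} (hN : 0 < N)
    (k : Fin 2 → Fin N) : IsCellTest fun x => (N : ℝ)⁻¹ • w (zoom N k x) := by
  refine ⟨?_, ?_⟩
  · refine contDiff_const.smul (hw.contDiff.comp ?_)
    unfold zoom; fun_prop
  · refine (tsupport_smul_subset_right (fun _ => (N : ℝ)⁻¹) _).trans fun x hx => ?_
    exact mem_openCell_of_zoom_mem hN (hw.tsupport_subset
      (tsupport_comp_subset_preimage w (continuous_zoom N k) hx))

theorem IsCellTest.fderiv_rescale {w : Plane → V} (hw : IsCellTest w) {N : ℕ} (hN : 0 < N)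
    (k : Fin 2 → Fin N) (x : Plane) :
    fderiv ℝ (fun x => (N : ℝ)⁻¹ • w (zoom N k x)) x = fderiv ℝ w (zoom N k x) := by
  have hN0 : (N : ℝ) ≠ 0 := by positivity
  have h1 : HasFDerivAt (zoom N k) ((N : ℝ) • ContinuousLinearMap.id ℝ Plane) x :=
    ((hasFDerivAt_id x).const_smul (N : ℝ)).sub_const _
  have h2 := ((hw.differentiable (zoom N k x)).hasFDerivAt.comp x h1).const_smul (N : ℝ)⁻¹
  refine h2.fderiv.trans ?_
  ext v
  simp [hN0]

/-- If at every frozen gradient `G` the energy `∫ f(G + Dw, G)` over test maps can be brought down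
to `Φ G`, then every test map can be perturbed so as to realize `∫ Φ(Dw)`. -/
theorem exists_refinement {f : (Plane →L[ℝ] V) → (Plane →L[ℝ] V) → ℝ}
    {Φ : (Plane →L[ℝ] V) → ℝ} (hf : Continuous fun p : (Plane →L[ℝ] V) × _ => f p.1 p.2)
    (hΦ : Continuous Φ)
    (h : ∀ G, ∀ ε > 0, ∃ w : Plane → V, IsCellTest w ∧
      ∫ x in cell, f (G + fderiv ℝ w x) G ≤ Φ G + ε)
    {w : Plane → V} (hw : IsCellTest w) {ε : ℝ} (hε : 0 < ε) :
    ∃ w' : Plane → V, IsCellTest w' ∧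
      ∫ x in cell, f (fderiv ℝ w' x) (fderiv ℝ w x) ≤ (∫ x in cell, Φ (fderiv ℝ w x)) + ε ∧
      ∀ x, ‖w' x - w x‖ ≤ ε := by
  set ε' := ε / 3 with hε'def
  have hε' : 0 < ε' := by positivity
  set D := fderiv ℝ w with hD
  have hDc : Continuous D := hw.continuous_fderiv
  choose W hW hWint using fun z : Plane => h (D z) ε' hε'
  choose b hb0 hb using fun z => (hW z).exists_bound
  -- `U z` collects the points at which the perturbation chosen for `D z` still works up to `ε'`. In
  -- the second clause `y` is idle; it lets the same compactness lemma serve both clauses.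
  set U : Plane → Set Plane := fun z => interior {x |
    (∀ y ∈ Metric.closedBall (0 : Plane) 1,
      f (D x + fderiv ℝ (W z) y) (D x) < f (D z + fderiv ℝ (W z) y) (D z) + ε') ∧
    (∀ y ∈ Metric.closedBall (0 : Plane) 1, Φ (D z) < Φ (D x) + ε')} with hU
  have hUnhds : ∀ z, U z ∈ 𝓝 z := by
    intro z
    rw [hU, interior_mem_nhds]
    have hWc := (hW z).continuous_fderiv
    refine Filter.inter_mem ?_ ?_
    · refine (isCompact_closedBall (0 : Plane) 1).eventually_forall_of_forall_eventually
        (P := fun x y => f (D x + fderiv ℝ (W z) y) (D x) <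
          f (D z + fderiv ℝ (W z) y) (D z) + ε') fun y _ => ?_
      have c1 : Continuous fun p : Plane × Plane => f (D p.1 + fderiv ℝ (W z) p.2) (D p.1) :=
        hf.comp (f := fun p : Plane × Plane => (D p.1 + fderiv ℝ (W z) p.2, D p.1))
          (by fun_prop)
      have c2 : Continuous fun p : Plane × Plane => f (D z + fderiv ℝ (W z) p.2) (D z) + ε' :=
        (hf.comp (f := fun p : Plane × Plane => (D z + fderiv ℝ (W z) p.2, D z))
          (by fun_prop)).add continuous_const
      exact c1.continuousAt.eventually_lt c2.continuousAt (by simpa using hε')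
    · refine (isCompact_closedBall (0 : Plane) 1).eventually_forall_of_forall_eventually
        (P := fun x _ => Φ (D z) < Φ (D x) + ε') fun y _ => ?_
      have c1 : Continuous fun p : Plane × Plane => Φ (D p.1) + ε' := by fun_prop
      exact continuousAt_const.eventually_lt c1.continuousAt (by simpa using hε')
  obtain ⟨t, -, ht⟩ := (isCompact_closedBall (0 : Plane) 1).elim_nhds_subcover U
    fun z _ => hUnhds z
  obtain ⟨δ, hδ, hball⟩ := lebesgue_number_lemma_of_metric (isCompact_closedBall (0 : Plane) 1)
    (c := fun z : t => U z) (fun _ => isOpen_interior)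
    (fun x hx => by
      obtain ⟨z, hzt, hxz⟩ := mem_iUnion₂.1 (ht hx)
      exact mem_iUnion.2 ⟨⟨z, hzt⟩, hxz⟩)
  set B := ∑ z ∈ t, b z with hB
  have hBle : ∀ z ∈ t, b z ≤ B := fun z hz => Finset.single_le_sum (fun i _ => hb0 i) hz
  -- `N > 1/δ` puts each small square inside one `U z`; `N > B/ε` makes the perturbation uniformly
  -- at most `ε`.
  obtain ⟨N, hN⟩ := exists_nat_gt (max (1 / δ) (B / ε))
  have hNδ : 1 / δ < N := (le_max_left _ _).trans_lt hN
  have hNB : B / ε < N := (le_max_right _ _).trans_lt hN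
  have hNp : (0 : ℝ) < N := lt_trans (by positivity) hNδ
  have hN0 : 0 < N := by exact_mod_cast hNp
  have hcenter : ∀ k : Fin 2 → Fin N, zoomCenter N k ∈ cell := fun k => by
    refine mem_cell_of_zoom_mem (k := k) hN0 ?_
    rw [zoom_zoomCenter hN0]
    intro i
    norm_num
  choose z hz using fun k : Fin 2 → Fin N =>
    hball (zoomCenter N k) (cell_subset_closedBall (hcenter k))
  have hsub : ∀ k x, zoom N k x ∈ cell → x ∈ U (z k) := by
    intro k x hx
    apply hz k
    rw [Metric.mem_ball, dist_eq_norm]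
    have h1 := norm_lt_one_of_mem_cell hx
    rw [zoom_eq_smul_sub hN0, norm_smul, Real.norm_of_nonneg hNp.le] at h1
    rw [div_lt_iff₀ hδ] at hNδ
    by_contra! hc
    nlinarith [mul_le_mul_of_nonneg_left hc hNp.le]
  set P : (Fin 2 → Fin N) → Plane → V := fun k x => (N : ℝ)⁻¹ • W (z k) (zoom N k x) with hP
  have hPtest : ∀ k, IsCellTest (P k) := fun k => (hW (z k)).rescale hN0 k
  have hPsum : IsCellTest (∑ k, P k) := IsCellTest.sum _ fun k _ => hPtest k
  have hfd : ∀ x, fderiv ℝ (w + ∑ k, P k) x = D x + ∑ k, fderiv ℝ (W (z k)) (zoom N k x) := by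
    intro x
    rw [fderiv_add (hw.differentiable x) (hPsum.differentiable x),
      fderiv_sum fun k _ => (hPtest k).differentiable x]
    congr 1
    exact Finset.sum_congr rfl fun k _ => (hW (z k)).fderiv_rescale hN0 k x
  have hfdk : ∀ k x, zoom N k x ∈ cell →
      fderiv ℝ (w + ∑ k, P k) x = D x + fderiv ℝ (W (z k)) (zoom N k x) := by
    intro k x hx
    rw [hfd, Finset.sum_eq_single k]
    · intro l _ hl
      exact (hW (z l)).fderiv_eq_zero_of_notMem fun hlx => hl (eq_of_zoom_mem hlx hx)
    · simp
  have hw' : IsCellTest (w + ∑ k, P k) := hw.add hPsum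
  have hcont' : Continuous fun x => f (fderiv ℝ (w + ∑ k, P k) x) (D x) :=
    hf.comp (f := fun x => (fderiv ℝ (w + ∑ k, P k) x, D x))
      (hw'.continuous_fderiv.prodMk hDc)
  have hmeas : ∀ k, MeasurableSet (zoom N k ⁻¹' cell) := fun k =>
    measurableSet_cell.preimage (continuous_zoom N k).measurable
  have hint : ∀ {F : Plane → ℝ} (_ : Continuous F) k, IntegrableOn F (zoom N k ⁻¹' cell) :=
    fun hF k => hF.integrableOn_cell.mono_set fun x hx => mem_cell_of_zoom_mem hN0 hx
  refine ⟨w + ∑ k, P k, hw', ?_, ?_⟩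
  · have hΦD : Continuous fun x => Φ (D x) + ε := by fun_prop
    have step : ∀ k, ∫ x in zoom N k ⁻¹' cell, f (fderiv ℝ (w + ∑ k, P k) x) (D x) ≤
        ∫ x in zoom N k ⁻¹' cell, (Φ (D x) + ε) := by
      intro k
      set G := D (z k)
      have hWc := (hW (z k)).continuous_fderiv
      have ch : Continuous fun y => f (G + fderiv ℝ (W (z k)) y) G + ε' :=
        (hf.comp (f := fun y => (G + fderiv ℝ (W (z k)) y, G)) (by fun_prop)).add continuous_const
      calc ∫ x in zoom N k ⁻¹' cell, f (fderiv ℝ (w + ∑ k, P k) x) (D x)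
          ≤ ∫ x in zoom N k ⁻¹' cell, (f (G + fderiv ℝ (W (z k)) (zoom N k x)) G + ε') := by
            refine setIntegral_mono_on (hint hcont' k)
              (hint (ch.comp (continuous_zoom N k)) k) (hmeas k) fun x hx => ?_
            rw [hfdk k x hx]
            exact ((interior_subset (hsub k x hx)).1 _ (cell_subset_closedBall hx)).le
        _ = ((N : ℝ) ^ 2)⁻¹ * ∫ y in cell, (f (G + fderiv ℝ (W (z k)) y) G + ε') :=
            setIntegral_zoom hN0 k fun y => f (G + fderiv ℝ (W (z k)) y) G + ε'
        _ ≤ ((N : ℝ) ^ 2)⁻¹ * ∫ _y in cell, (Φ G + 2 * ε') := by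
            refine mul_le_mul_of_nonneg_left ?_ (by positivity)
            have ci : Continuous fun y => f (G + fderiv ℝ (W (z k)) y) G :=
              hf.comp (f := fun y => (G + fderiv ℝ (W (z k)) y, G)) (by fun_prop)
            rw [integral_add ci.integrableOn_cell
              continuous_const.integrableOn_cell, setIntegral_cell_const,
              setIntegral_cell_const]
            linarith [hWint (z k)]
        _ = ∫ x in zoom N k ⁻¹' cell, (Φ G + 2 * ε') :=
            (setIntegral_zoom hN0 k fun _ => Φ G + 2 * ε').symm
        _ ≤ _ := by
            refine setIntegral_mono_on (hint continuous_const k) (hint hΦD k) (hmeas k)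
              fun x hx => ?_
            have := (interior_subset (hsub k x hx)).2 0 (by simp)
            linarith
    calc _ = ∑ k, ∫ x in zoom N k ⁻¹' cell, f (fderiv ℝ (w + ∑ k, P k) x) (D x) :=
          setIntegral_cell_eq_sum hN0 hcont'.integrableOn_cell
      _ ≤ ∑ k, ∫ x in zoom N k ⁻¹' cell, (Φ (D x) + ε) := Finset.sum_le_sum fun k _ => step k
      _ = ∫ x in cell, (Φ (D x) + ε) := (setIntegral_cell_eq_sum hN0 hΦD.integrableOn_cell).symm
      _ = (∫ x in cell, Φ (D x)) + ε := by
        have ci : Continuous fun x => Φ (D x) := hΦ.comp hDc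
        rw [integral_add ci.integrableOn_cell continuous_const.integrableOn_cell,
          setIntegral_cell_const]
  · intro x
    rw [Pi.add_apply, add_sub_cancel_left, Finset.sum_apply]
    have hterm : ∀ k, ‖P k x‖ ≤ ε := fun k => by
      rw [hP, norm_smul, norm_inv, Real.norm_of_nonneg hNp.le, inv_mul_le_iff₀ hNp]
      rw [div_lt_iff₀ hε] at hNB
      exact ((hb _ _).trans (hBle _ (z k).2)).trans hNB.le
    by_cases hx : x ∈ cell
    · obtain ⟨k, hk⟩ := exists_zoom_mem hN0 hx
      rw [Finset.sum_eq_single k]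
      · exact hterm k
      · intro l _ hl
        simp only [hP]
        rw [(hW (z l)).eq_zero_of_notMem fun hlx => hl (eq_of_zoom_mem hlx hk), smul_zero]
      · simp
    · rw [Finset.sum_eq_zero, norm_zero]
      · exact hε.le
      · exact fun k _ => (hPtest k).eq_zero_of_notMem hx

end Refinement

/-! ### One-dimensional oscillations and cutoffs. -/

theorem setIntegral_cell_comp_apply (i : Fin 2) {h : ℝ → ℝ} (hh : Continuous h) :
    ∫ x in cell, h (x i) = ∫ t in (-(1 / 2) : ℝ)..(1 / 2), h t := by
  have h1 : ∫ x in cell, h (x i) =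
      ∫ y in univ.pi fun _ : Fin 2 => Ico (-(1 / 2) : ℝ) (1 / 2), h (y i) := by
    rw [cell_eq_preimage]
    exact (PiLp.volume_preserving_ofLp (Fin 2)).setIntegral_preimage_emb
      (MeasurableEquiv.toLp 2 (Fin 2 → ℝ)).symm.measurableEmbedding (fun y => h (y i)) _
  have hprob : IsProbabilityMeasure (volume.restrict (Ico (-(1 / 2) : ℝ) (1 / 2))) :=
    ⟨by simp; norm_num⟩
  rw [h1, volume_pi, Measure.restrict_pi_pi,
    intervalIntegral.integral_of_le (by norm_num), integral_Ioc_eq_integral_Ioo,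
    ← integral_Ico_eq_integral_Ioo]
  have hmp := measurePreserving_eval
    (fun _ : Fin 2 => volume.restrict (Ico (-(1 / 2) : ℝ) (1 / 2))) i
  have h2 := integral_map (f := h)
    (μ := Measure.pi fun _ : Fin 2 => volume.restrict (Ico (-(1 / 2) : ℝ) (1 / 2))) hmp.measurable.aemeasurable hh.aestronglyMeasurable
  rw [hmp.map_eq] at h2
  exact h2.symm

theorem intervalIntegral_comp_nat_mul {h : ℝ → ℝ} (hh : Continuous h) (hp : Function.Periodic h 1)
    {N : ℕ} (hN : 0 < N) :
    ∫ t in (-(1 / 2) : ℝ)..(1 / 2), h (N * t) = ∫ t in (-(1 / 2) : ℝ)..(1 / 2), h t := by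
  have hN0 : (N : ℝ) ≠ 0 := by positivity
  rw [intervalIntegral.integral_comp_mul_left _ hN0]
  have h1 := hp.intervalIntegral_add_zsmul_eq N (N * -(1 / 2) : ℝ)
    fun _ _ => hh.intervalIntegrable _ _
  have e1 : (N * -(1 / 2) : ℝ) + (N : ℤ) • (1 : ℝ) = N * (1 / 2) := by
    simp only [zsmul_eq_mul, Int.cast_natCast]; ring
  rw [e1] at h1
  rw [h1, hp.intervalIntegral_add_eq (N * -(1 / 2) : ℝ) (-(1 / 2))]
  simp only [zsmul_eq_mul, Int.cast_natCast, smul_eq_mul]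
  rw [inv_mul_cancel_left₀ hN0]
  norm_num

/-- Mean zero makes the primitive periodic, hence bounded, so that `g (N t) / N` is small with
derivative `p (N t)`. -/
theorem exists_periodic_antiderivative {p : ℝ → ℝ} (hp : ContDiff ℝ (⊤ : ℕ∞) p)
    (hper : Function.Periodic p 1) (hmean : ∫ t in (-(1 / 2) : ℝ)..(1 / 2), p t = 0) :
    ∃ g : ℝ → ℝ, ContDiff ℝ (⊤ : ℕ∞) g ∧ (∀ t, HasDerivAt g (p t) t) ∧ ∃ b, ∀ t, |g t| ≤ b := by
  have hc := hp.continuous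
  set g : ℝ → ℝ := fun t => ∫ s in (0 : ℝ)..t, p s with hg
  have hd : ∀ t, HasDerivAt g (p t) t := fun t =>
    intervalIntegral.integral_hasDerivAt_right (hc.intervalIntegrable _ _)
      (hc.stronglyMeasurableAtFilter _ _) hc.continuousAt
  have hdiff : Differentiable ℝ g := fun t => (hd t).differentiableAt
  have hgper : Function.Periodic g 1 := fun t => by
    have h1 := hper.intervalIntegral_add_eq_add 0 t fun _ _ => hc.intervalIntegrable _ _
    have h2 := hper.intervalIntegral_add_eq 0 (-(1 / 2))
    have h3 : (-(1 / 2) : ℝ) + 1 = 1 / 2 := by norm_num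
    rw [h3, hmean] at h2
    simp only [hg]
    rw [h1, h2, add_zero]
  refine ⟨g, contDiff_infty_iff_deriv.2 ⟨hdiff, ?_⟩, hd, ?_⟩
  · have : deriv g = p := funext fun t => (hd t).deriv
    rwa [this]
  · obtain ⟨b, hb⟩ := (hgper.isBounded_of_continuous one_ne_zero
      hdiff.continuous).exists_norm_le
    exact ⟨b, fun t => hb _ (mem_range_self t)⟩

/-- A smooth function of period `1` thus singles out an interval of length `l` in each period. -/
theorem cos_lt_cos_two_pi_mul_iff {l t : ℝ} (hl0 : 0 ≤ l) (hl1 : l ≤ 1)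
    (ht : t ∈ Ioc (-(1 / 2) : ℝ) (1 / 2)) :
    Real.cos (Real.pi * l) < Real.cos (2 * Real.pi * t) ↔ t ∈ Ioo (-(l / 2)) (l / 2) := by
  have hpi := Real.pi_pos
  have habs : |t| ≤ 1 / 2 := abs_le.2 ⟨ht.1.le, ht.2⟩
  have e : Real.cos (2 * Real.pi * t) = Real.cos (2 * Real.pi * |t|) := by
    rw [← Real.cos_abs (2 * Real.pi * t), abs_mul, abs_of_pos (by positivity : 0 < 2 * Real.pi)]
  rw [e, Real.strictAntiOn_cos.lt_iff_gt ⟨by positivity, by nlinarith⟩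
    ⟨by positivity, by nlinarith⟩, mem_Ioo, ← abs_lt]
  constructor <;> intro h <;> nlinarith

/-- A smooth 1-periodic profile with mean zero that is close in distribution to taking the value
`c (1 - l)` with probability `l` and `-c l` with probability `1 - l`. -/
theorem exists_periodic_profile {Ψ : ℝ → ℝ} (hΨ : Continuous Ψ) {l : ℝ} (hl0 : 0 ≤ l)
    (hl1 : l ≤ 1) (c : ℝ) {ε : ℝ} (hε : 0 < ε) :
    ∃ p : ℝ → ℝ, ContDiff ℝ (⊤ : ℕ∞) p ∧ Function.Periodic p 1 ∧
      (∫ t in (-(1 / 2) : ℝ)..(1 / 2), p t = 0) ∧ (∀ t, |p t| ≤ |c|) ∧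
      ∫ t in (-(1 / 2) : ℝ)..(1 / 2), Ψ (p t) ≤
        l * Ψ (c * (1 - l)) + (1 - l) * Ψ (-(c * l)) + ε := by
  set β : ℕ → ℝ → ℝ := fun n t =>
    Real.smoothTransition (n * (Real.cos (2 * Real.pi * t) - Real.cos (Real.pi * l))) with hβ
  have hβs : ∀ n, ContDiff ℝ (⊤ : ℕ∞) (β n) := fun n =>
    Real.smoothTransition.contDiff.comp (by fun_prop)
  have hβp : ∀ n, Function.Periodic (β n) 1 := fun n t => by
    simp only [hβ, mul_add, mul_one, Real.cos_add_two_pi]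
  have hβ01 : ∀ n t, β n t ∈ Icc (0 : ℝ) 1 := fun n t =>
    ⟨Real.smoothTransition.nonneg _, Real.smoothTransition.le_one _⟩
  set χ : ℝ → ℝ := (Ioo (-(l / 2)) (l / 2)).indicator fun _ => (1 : ℝ) with hχ
  have hβlim : ∀ t ∈ Ioc (-(1 / 2) : ℝ) (1 / 2), Tendsto (fun n => β n t) atTop (𝓝 (χ t)) := by
    intro t ht
    by_cases h : t ∈ Ioo (-(l / 2)) (l / 2)
    · rw [hχ, indicator_of_mem h]
      have hpos := sub_pos.2 ((cos_lt_cos_two_pi_mul_iff hl0 hl1 ht).2 h)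
      refine tendsto_const_nhds.congr' ?_
      filter_upwards [(tendsto_natCast_atTop_atTop.atTop_mul_const hpos).eventually_ge_atTop 1]
        with n hn
      exact (Real.smoothTransition.one_of_one_le hn).symm
    · rw [hχ, indicator_of_notMem h]
      have hneg := not_lt.1 (mt (cos_lt_cos_two_pi_mul_iff hl0 hl1 ht).1 h)
      refine tendsto_const_nhds.congr fun n => ?_
      exact (Real.smoothTransition.zero_of_nonpos
        (mul_nonpos_of_nonneg_of_nonpos (Nat.cast_nonneg n) (sub_nonpos.2 hneg))).symm
  have hsub : Ioo (-(l / 2)) (l / 2) ⊆ Ioc (-(1 / 2) : ℝ) (1 / 2) := fun t ht =>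
    ⟨by linarith [ht.1], by linarith [ht.2]⟩
  have hχint : ∫ t in (-(1 / 2) : ℝ)..(1 / 2), χ t = l := by
    rw [intervalIntegral.integral_of_le (by norm_num), hχ, integral_indicator measurableSet_Ioo,
      Measure.restrict_restrict measurableSet_Ioo,
      inter_eq_left.2 hsub]
    simp [hl0]
  have hχii : IntervalIntegrable χ volume (-(1 / 2) : ℝ) (1 / 2) := by
    rw [intervalIntegrable_iff_integrableOn_Ioc_of_le (by norm_num)]
    exact (integrable_const (1 : ℝ)).indicator measurableSet_Ioo
  set μ : ℕ → ℝ := fun n => ∫ t in (-(1 / 2) : ℝ)..(1 / 2), β n t with hμ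
  have hIoc : uIoc (-(1 / 2) : ℝ) (1 / 2) = Ioc (-(1 / 2) : ℝ) (1 / 2) :=
    uIoc_of_le (by norm_num)
  have hμlim : Tendsto μ atTop (𝓝 l) := by
    rw [← hχint]
    refine intervalIntegral.tendsto_integral_filter_of_dominated_convergence (fun _ => 1)
      (Eventually.of_forall fun n => (hβs n).continuous.aestronglyMeasurable)
      (Eventually.of_forall fun n => ae_of_all _ fun t _ => ?_) (by simp)
      (ae_of_all _ fun t ht => hβlim t (hIoc ▸ ht))
    rw [Real.norm_of_nonneg (hβ01 n t).1]
    exact (hβ01 n t).2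
  have hμ01 : ∀ n, μ n ∈ Icc (0 : ℝ) 1 := fun n => by
    have h1 : ∫ _ in (-(1 / 2) : ℝ)..(1 / 2), (1 : ℝ) = 1 := by norm_num
    refine ⟨intervalIntegral.integral_nonneg (by norm_num) fun t _ => (hβ01 n t).1, ?_⟩
    rw [← h1]
    exact intervalIntegral.integral_mono_on (by norm_num)
      ((hβs n).continuous.intervalIntegrable _ _) (by simp) fun t _ => (hβ01 n t).2
  -- Subtracting the actual mean `μ n` instead of its limit `l` keeps the mean exactly zero for
  -- every `n`.
  set p : ℕ → ℝ → ℝ := fun n t => c * (β n t - μ n) with hp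
  have hpb : ∀ n t, |p n t| ≤ |c| := fun n t => by
    rw [hp, abs_mul]
    refine mul_le_of_le_one_right (abs_nonneg c) (abs_le.2 ⟨?_, ?_⟩) <;>
      linarith [(hβ01 n t).1, (hβ01 n t).2, (hμ01 n).1, (hμ01 n).2]
  have hps : ∀ n, ContDiff ℝ (⊤ : ℕ∞) (p n) := fun n =>
    contDiff_const.mul ((hβs n).sub contDiff_const)
  obtain ⟨B, hB⟩ := (isCompact_Icc (a := -|c|) (b := |c|)).exists_bound_of_continuousOn
    hΨ.continuousOn
  have hlim : Tendsto (fun n => ∫ t in (-(1 / 2) : ℝ)..(1 / 2), Ψ (p n t)) atTop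
      (𝓝 (∫ t in (-(1 / 2) : ℝ)..(1 / 2), Ψ (c * (χ t - l)))) := by
    refine intervalIntegral.tendsto_integral_filter_of_dominated_convergence (fun _ => B)
      (Eventually.of_forall fun n => (hΨ.comp (hps n).continuous).aestronglyMeasurable)
      (Eventually.of_forall fun n => ae_of_all _ fun t _ => hB _ (abs_le.1 (hpb n t))) (by simp)
      (ae_of_all _ fun t ht => ?_)
    exact (hΨ.tendsto _).comp (((hβlim t (hIoc ▸ ht)).sub hμlim).const_mul c)
  have hval : ∫ t in (-(1 / 2) : ℝ)..(1 / 2), Ψ (c * (χ t - l)) =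
      l * Ψ (c * (1 - l)) + (1 - l) * Ψ (-(c * l)) := by
    have : ∀ t, Ψ (c * (χ t - l)) =
        Ψ (-(c * l)) + χ t * (Ψ (c * (1 - l)) - Ψ (-(c * l))) := fun t => by
      by_cases h : t ∈ Ioo (-(l / 2)) (l / 2)
      · simp [hχ, indicator_of_mem h]
      · simp [hχ, indicator_of_notMem h]
    simp_rw [this]
    rw [intervalIntegral.integral_add (by simp) (hχii.mul_const _),
      intervalIntegral.integral_mul_const, hχint]
    norm_num
    ring
  rw [hval] at hlim
  obtain ⟨n, hn⟩ := (hlim.eventually (gt_mem_nhds (lt_add_of_pos_right _ hε))).exists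
  refine ⟨p n, hps n, fun t => by simp only [hp, hβp n t], ?_, hpb n, hn.le⟩
  simp only [hp]
  rw [intervalIntegral.integral_const_mul, intervalIntegral.integral_sub
    ((hβs n).continuous.intervalIntegrable _ _) (by simp)]
  simp only [intervalIntegral.integral_const]
  norm_num [hμ]

theorem volume_openCell : volume openCell = 1 := by
  have : openCell = WithLp.ofLp ⁻¹' (univ.pi fun _ => Ioo (-(1 / 2) : ℝ) (1 / 2)) := by
    ext x; simp [openCell]
  rw [this, (PiLp.volume_preserving_ofLp (Fin 2)).measure_preimage
    (MeasurableSet.univ_pi fun _ => measurableSet_Ioo).nullMeasurableSet, Real.volume_pi_Ioo]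
  norm_num

/-- Smooth cutoffs of the open unit square that equal `1` near a compact set of almost full
measure. -/
theorem exists_cutoff {ε : ℝ} (hε : 0 < ε) :
    ∃ (χ : Plane → ℝ) (K : Set Plane), IsCellTest χ ∧ IsCompact K ∧ K ⊆ cell ∧
      volume.real (cell \ K) ≤ ε ∧ (∀ x, χ x ∈ Icc (0 : ℝ) 1) ∧ ∀ x ∈ K, ∀ᶠ y in 𝓝 x, χ y = 1 := by
  obtain ⟨K, hKs, hK, hKε⟩ := isOpen_openCell.measurableSet.exists_isCompact_sdiff_lt
    (μ := volume) (by rw [volume_openCell]; simp) (ε := ENNReal.ofReal ε) (by simpa using hε)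
  have hKc : K ⊆ cell := hKs.trans openCell_subset_cell
  obtain ⟨χ, h0, h1, h01⟩ := exists_contMDiffMap_zero_one_nhds_of_isClosed
    (modelWithCornersSelf ℝ Plane) (n := (⊤ : ℕ∞)) isOpen_openCell.isClosed_compl hK.isClosed
    (disjoint_left.2 fun x hx hxK => hx (hKs hxK))
  refine ⟨χ, K, ⟨χ.contMDiff.contDiff, fun x hx => ?_⟩, hK, hKc, ?_, h01, fun x hx => ?_⟩
  · by_contra hxo
    exact (notMem_tsupport_iff_eventuallyEq.2 (eventually_nhdsSet_iff_forall.1 h0 x hxo)) hx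
  · refine ENNReal.toReal_le_of_le_ofReal hε.le (le_trans (le_of_eq ?_) hKε.le)
    rw [measure_sdiff hKc hK.measurableSet.nullMeasurableSet hK.measure_ne_top,
      measure_sdiff hKs hK.measurableSet.nullMeasurableSet hK.measure_ne_top, volume_cell,
      volume_openCell]
  · exact eventually_nhdsSet_iff_forall.1 h1 x hx

/-! ### Simple laminates and rank-one convexity of the relaxation. -/

section Lamination

variable {V : Type*} [NormedAddCommGroup V] [NormedSpace ℝ V]

/-- The rank-one map `x ↦ x i • v`. -/
noncomputable def rankOne (i : Fin 2) (v : V) : Plane →L[ℝ] V :=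
  (EuclideanSpace.proj i : Plane →L[ℝ] ℝ).smulRight v

/-- The map oscillates in the direction `x i`, with a two-valued profile up to smoothing, and is cut
off near the boundary of the square. On `K` its gradient is exactly `p (N * x i) • R`; off `K` the
gradient is merely bounded, but that set has small measure. -/
theorem exists_lamination [FiniteDimensional ℝ V] {Φ : (Plane →L[ℝ] V) → ℝ} (hΦ : Continuous Φ)
    (hΦ0 : ∀ G, 0 ≤ Φ G) (F : Plane →L[ℝ] V) (i : Fin 2) (v : V) {l : ℝ} (hl0 : 0 ≤ l)
    (hl1 : l ≤ 1) (c : ℝ) {ε : ℝ} (hε : 0 < ε) :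
    ∃ w : Plane → V, IsCellTest w ∧ ∫ x in cell, Φ (F + fderiv ℝ w x) ≤
      l * Φ (F + (c * (1 - l)) • rankOne i v) + (1 - l) * Φ (F + (-(c * l)) • rankOne i v) + ε := by
  set R := rankOne i v with hR
  have hΨ : Continuous fun z : ℝ => Φ (F + z • R) := by fun_prop
  obtain ⟨p, hp, hper, hmean, hpc, hpint⟩ := exists_periodic_profile hΨ hl0 hl1 c (half_pos hε)
  obtain ⟨g, hg, hgd, b, hb⟩ := exists_periodic_antiderivative hp hper hmean
  have hproper : ProperSpace (Plane →L[ℝ] V) := FiniteDimensional.proper ℝ _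
  obtain ⟨B, hB⟩ := (isCompact_closedBall F (|c| * ‖R‖ + ‖v‖)).exists_bound_of_continuousOn
    hΦ.continuousOn
  have hB0 : 0 ≤ B := (norm_nonneg _).trans (hB F (by simp; positivity))
  obtain ⟨χ, K, hχ, hK, hKc, hKε, hχ01, hχ1⟩ := exists_cutoff
    (show 0 < ε / (2 * (B + 1)) by positivity)
  obtain ⟨C, hC⟩ := hχ.continuous_fderiv.bounded_above_of_compact_support
    (hχ.hasCompactSupport.fderiv ℝ)
  have hb0 : 0 ≤ b := (abs_nonneg _).trans (hb 0)
  have hC0 : 0 ≤ C := (norm_nonneg _).trans (hC 0)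
  -- This frequency bounds the term containing the derivative of the cutoff by `‖v‖`, so all
  -- gradients stay in the ball on which `B` bounds `Φ`.
  obtain ⟨N, hN⟩ := exists_nat_gt (b * C)
  have hNp : (0 : ℝ) < N := lt_of_le_of_lt (by positivity) hN
  have hN0 : 0 < N := by exact_mod_cast hNp
  set w : Plane → V := fun x => χ x • (((N : ℝ)⁻¹ * g (N * x i)) • v) with hwdef
  have hcoord : ContDiff ℝ (⊤ : ℕ∞) fun x : Plane => (N : ℝ) * x i := by fun_prop
  have hw : IsCellTest w := by
    refine ⟨hχ.contDiff.smul ((contDiff_const.mul (hg.comp hcoord)).smul contDiff_const), ?_⟩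
    exact (tsupport_smul_subset_left χ _).trans hχ.tsupport_subset
  have hfd : ∀ x, fderiv ℝ w x = (χ x * p (N * x i)) • R +
      ((N : ℝ)⁻¹ * g (N * x i)) • (fderiv ℝ χ x).smulRight v := by
    intro x
    have h1 : HasFDerivAt (fun x : Plane => (N : ℝ) * x i)
        ((N : ℝ) • (EuclideanSpace.proj i : Plane →L[ℝ] ℝ)) x :=
      (EuclideanSpace.proj i : Plane →L[ℝ] ℝ).hasFDerivAt.const_mul _
    have h2 := ((hgd (N * x i)).comp_hasFDerivAt x h1).const_mul (N : ℝ)⁻¹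
    have h3 := (hχ.differentiable x).hasFDerivAt.smul (h2.smul_const v)
    refine h3.fderiv.trans ?_
    ext y
    simp only [hR, rankOne, add_apply, smul_apply,
      ContinuousLinearMap.smulRight_apply, smul_smul, ← add_smul, smul_eq_mul, Function.comp_apply]
    congr 1
    have : (N : ℝ) ≠ 0 := hNp.ne'
    field_simp
  have hnorm : ∀ x, ‖fderiv ℝ w x‖ ≤ |c| * ‖R‖ + ‖v‖ := by
    intro x
    rw [hfd]
    refine (norm_add_le _ _).trans (add_le_add ?_ ?_)
    · rw [norm_smul, norm_mul]
      refine mul_le_mul_of_nonneg_right ?_ (norm_nonneg _)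
      rw [Real.norm_of_nonneg (hχ01 x).1]
      refine (mul_le_of_le_one_left (norm_nonneg _) (hχ01 x).2).trans (hpc _)
    · rw [norm_smul, ContinuousLinearMap.norm_smulRight_apply, ← mul_assoc]
      refine mul_le_of_le_one_left (norm_nonneg _) ?_
      rw [norm_mul, norm_inv, Real.norm_of_nonneg hNp.le, mul_assoc, inv_mul_le_iff₀ hNp, mul_one]
      exact (mul_le_mul (hb _) (hC x) (norm_nonneg _) hb0).trans hN.le
  refine ⟨w, hw, ?_⟩
  have hpc' : Continuous fun x : Plane => Φ (F + p (N * x i) • R) :=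
    hΨ.comp (hp.continuous.comp hcoord.continuous)
  have hLint : Continuous fun x => Φ (F + fderiv ℝ w x) :=
    hΦ.comp (continuous_const.add hw.continuous_fderiv)
  have hind : IntegrableOn ((cell \ K).indicator fun _ => B) cell :=
    ((continuous_const.integrableOn_cell).indicator
      (measurableSet_cell.diff hK.measurableSet))
  calc ∫ x in cell, Φ (F + fderiv ℝ w x)
      ≤ ∫ x in cell, (Φ (F + p (N * x i) • R) + (cell \ K).indicator (fun _ => B) x) := by
        refine setIntegral_mono_on hLint.integrableOn_cell (hpc'.integrableOn_cell.add hind)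
          measurableSet_cell fun x hx => ?_
        by_cases hxK : x ∈ K
        · have e1 : fderiv ℝ χ x = 0 := by
            rw [Filter.EventuallyEq.fderiv_eq (f := fun _ => (1 : ℝ)) (hχ1 x hxK)]
            simp
          rw [hfd, e1, (hχ1 x hxK).self_of_nhds, indicator_of_notMem fun h => h.2 hxK]
          simp
        · rw [indicator_of_mem (show x ∈ cell \ K from ⟨hx, hxK⟩)]
          have h1 := hB (F + fderiv ℝ w x) (by simpa using hnorm x)
          linarith [hΦ0 (F + p (N * x i) • R), Real.le_norm_self (Φ (F + fderiv ℝ w x))]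
    _ = (∫ t in (-(1 / 2) : ℝ)..(1 / 2), Φ (F + p t • R)) + volume.real (cell \ K) * B := by
        rw [integral_add hpc'.integrableOn_cell hind]
        congr 1
        · have hc : Continuous fun t => Φ (F + p t • R) := hΨ.comp hp.continuous
          -- By periodicity the average over the square is exact for every positive integer `N`.
          rw [← intervalIntegral_comp_nat_mul hc (fun t => by simp only [hper t]) hN0]
          exact setIntegral_cell_comp_apply i
            (h := fun t => Φ (F + p (N * t) • R)) (by fun_prop)
        · rw [setIntegral_indicator (measurableSet_cell.diff hK.measurableSet),
            inter_eq_right.2 sdiff_subset, setIntegral_const, smul_eq_mul]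
    _ ≤ _ := by
        have h1 : volume.real (cell \ K) * B ≤ ε / (2 * (B + 1)) * (B + 1) :=
          mul_le_mul hKε (by linarith) hB0 (by positivity)
        have h2 : ε / (2 * (B + 1)) * (B + 1) = ε / 2 := by field_simp
        linarith

theorem continuous_setIntegral_cell_add {f : (Plane →L[ℝ] V) → ℝ} (hf : Continuous f)
    {D : Plane → Plane →L[ℝ] V} (hD : Continuous D) :
    Continuous fun G => ∫ x in cell, f (G + D x) := by
  refine continuous_iff_continuousAt.2 fun G₀ => Metric.tendsto_nhds.2 fun ε hε => ?_
  have hev : ∀ᶠ G in 𝓝 G₀, ∀ y ∈ Metric.closedBall (0 : Plane) 1,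
      |f (G + D y) - f (G₀ + D y)| < ε / 2 := by
    refine (isCompact_closedBall (0 : Plane) 1).eventually_forall_of_forall_eventually
      (P := fun G y => |f (G + D y) - f (G₀ + D y)| < ε / 2) fun y _ => ?_
    have c1 : Continuous fun q : (Plane →L[ℝ] V) × Plane =>
      |f (q.1 + D q.2) - f (G₀ + D q.2)| := by fun_prop
    exact c1.continuousAt.eventually_lt continuousAt_const (by simpa using hε)
  filter_upwards [hev] with G hG
  have hc : ∀ G, Continuous fun x => f (G + D x) := fun G => by fun_prop
  rw [Real.dist_eq, ← integral_sub (hc G).integrableOn_cell (hc G₀).integrableOn_cell]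
  have := norm_setIntegral_le_of_norm_le_const (μ := volume) (s := cell) (C := ε / 2)
    volume_cell_lt_top (f := fun x => f (G + D x) - f (G₀ + D x))
    fun x hx => (hG x (cell_subset_closedBall hx)).le
  rw [measureReal_def, volume_cell] at this
  simp only [ENNReal.toReal_one, mul_one, Real.norm_eq_abs] at this
  linarith

/-- The relaxed energy density: the infimum of `∫ f(F + Dw)` over all test maps `w`. -/
noncomputable def relaxed (f : (Plane →L[ℝ] V) → ℝ) (F : Plane →L[ℝ] V) : ℝ :=
  sInf {I | ∃ w : Plane → V, IsCellTest w ∧ I = ∫ x in cell, f (F + fderiv ℝ w x)}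

theorem bddBelow_energies {f : (Plane →L[ℝ] V) → ℝ} (hf0 : ∀ G, 0 ≤ f G) (F : Plane →L[ℝ] V) :
    BddBelow {I | ∃ w : Plane → V, IsCellTest w ∧ I = ∫ x in cell, f (F + fderiv ℝ w x)} :=
  ⟨0, by rintro _ ⟨w, -, rfl⟩; exact integral_nonneg fun x => hf0 _⟩

theorem relaxed_le_setIntegral {f : (Plane →L[ℝ] V) → ℝ} (hf0 : ∀ G, 0 ≤ f G)
    (F : Plane →L[ℝ] V) {w : Plane → V} (hw : IsCellTest w) :
    relaxed f F ≤ ∫ x in cell, f (F + fderiv ℝ w x) :=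
  csInf_le (bddBelow_energies hf0 F) ⟨w, hw, rfl⟩

theorem relaxed_le {f : (Plane →L[ℝ] V) → ℝ} (hf0 : ∀ G, 0 ≤ f G) (F : Plane →L[ℝ] V) :
    relaxed f F ≤ f F := by
  have := relaxed_le_setIntegral hf0 F (IsCellTest.zero (V := V))
  simpa [measureReal_def, volume_cell] using this

theorem exists_setIntegral_lt_relaxed {f : (Plane →L[ℝ] V) → ℝ} (F : Plane →L[ℝ] V)
    {ε : ℝ} (hε : 0 < ε) :
    ∃ w : Plane → V, IsCellTest w ∧ ∫ x in cell, f (F + fderiv ℝ w x) < relaxed f F + ε := by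
  obtain ⟨_, ⟨w, hw, rfl⟩, h⟩ := exists_lt_of_csInf_lt
    (s := {I | ∃ w : Plane → V, IsCellTest w ∧ I = ∫ x in cell, f (F + fderiv ℝ w x)})
    ⟨_, 0, IsCellTest.zero, rfl⟩ (lt_add_of_pos_right (relaxed f F) hε)
  exact ⟨w, hw, h⟩

/-- The relaxed energy density is convex along rank-one lines. -/
theorem convexOn_relaxed [FiniteDimensional ℝ V] {f : (Plane →L[ℝ] V) → ℝ} (hf : Continuous f)
    (hf0 : ∀ G, 0 ≤ f G) (F : Plane →L[ℝ] V) (i : Fin 2) (v : V) :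
    ConvexOn ℝ univ fun z : ℝ => relaxed f (F + z • rankOne i v) := by
  refine ⟨convex_univ, fun z₁ _ z₂ _ a b ha hb hab => ?_⟩
  set R := rankOne i v
  simp only [smul_eq_mul]
  refine le_of_forall_pos_le_add fun ε hε => ?_
  obtain ⟨w₁, hw₁, h₁⟩ := exists_setIntegral_lt_relaxed (f := f) (F + z₁ • R)
    (show 0 < ε / 3 by positivity)
  obtain ⟨w₂, hw₂, h₂⟩ := exists_setIntegral_lt_relaxed (f := f) (F + z₂ • R)
    (show 0 < ε / 3 by positivity)
  -- Taking the minimum of the two near-optimal energies gives one continuous density for the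
  -- laminate. The refinement then inserts `w₁` or `w₂` according to which is cheaper at the frozen
  -- gradient.
  set Φ : (Plane →L[ℝ] V) → ℝ := fun G =>
    min (∫ x in cell, f (G + fderiv ℝ w₁ x)) (∫ x in cell, f (G + fderiv ℝ w₂ x)) with hΦdef
  have hΦ : Continuous Φ := (continuous_setIntegral_cell_add hf hw₁.continuous_fderiv).min
    (continuous_setIntegral_cell_add hf hw₂.continuous_fderiv)
  have hΦ0 : ∀ G, 0 ≤ Φ G := fun G =>
    le_min (integral_nonneg fun _ => hf0 _) (integral_nonneg fun _ => hf0 _)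
  set F' := F + (a * z₁ + b * z₂) • R with hF'
  have hb' : b = 1 - a := by linarith
  obtain ⟨w, hw, hwint⟩ := exists_lamination hΦ hΦ0 F' i v ha (by linarith) (z₁ - z₂)
    (show 0 < ε / 3 by positivity)
  have e1 : F' + ((z₁ - z₂) * (1 - a)) • R = F + z₁ • R := by
    rw [hF', add_assoc, ← add_smul, hb']; congr 2; ring
  have e2 : F' + (-((z₁ - z₂) * a)) • R = F + z₂ • R := by
    rw [hF', add_assoc, ← add_smul, hb']; congr 2; ring
  rw [e1, e2] at hwint
  obtain ⟨w', hw', hw'int, -⟩ := exists_refinement (f := fun H _ => f (F' + H))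
    (Φ := fun G => Φ (F' + G)) (by fun_prop) (by fun_prop) (fun G η hη => by
      rcases min_choice (∫ x in cell, f (F' + G + fderiv ℝ w₁ x))
        (∫ x in cell, f (F' + G + fderiv ℝ w₂ x)) with h | h
      · exact ⟨w₁, hw₁, by simp only [hΦdef, h, ← add_assoc]; linarith⟩
      · exact ⟨w₂, hw₂, by simp only [hΦdef, h, ← add_assoc]; linarith⟩)
    hw (show 0 < ε / 3 by positivity)
  have h := relaxed_le_setIntegral hf0 F' hw'
  have m1 : Φ (F + z₁ • R) ≤ relaxed f (F + z₁ • R) + ε / 3 := (min_le_left _ _).trans h₁.le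
  have m2 : Φ (F + z₂ • R) ≤ relaxed f (F + z₂ • R) + ε / 3 := (min_le_right _ _).trans h₂.le
  have k1 := mul_le_mul_of_nonneg_left m1 ha
  have k2 := mul_le_mul_of_nonneg_left m2 hb
  rw [← hb'] at hwint
  have k3 : a * (ε / 3) + b * (ε / 3) = ε / 3 := by rw [← add_mul, hab, one_mul]
  linarith

end Lamination

/-! ### The differential inclusion for the pair `(u, ψ)`. -/

theorem defect_nonneg (κ r x s : ℝ) : 0 ≤ defect κ r x s := by
  unfold defect; positivity

theorem Continuous.defect {X : Type*} [TopologicalSpace X] {κ r : ℝ} (hr : 1 < r) {x s : X → ℝ}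
    (hx : Continuous x) (hs : Continuous s) : Continuous fun p => defect κ r (x p) (s p) := by
  unfold _root_.defect wave
  refine Continuous.mul (by fun_prop) (Continuous.rpow_const (by fun_prop) fun p => Or.inr ?_)
  linarith

theorem abs_sub_le_defect {κ r : ℝ} (hr : 1 < r) (x s : ℝ) : |wave κ x - s| ≤ defect κ r x s := by
  refine le_mul_of_one_le_right (abs_nonneg _) (Real.one_le_rpow ?_ (by linarith))
  linarith [abs_nonneg x, abs_nonneg s]

/-- The standard basis vectors of the plane. -/
noncomputable abbrev basisVec (i : Fin 2) : Plane := EuclideanSpace.single i (1 : ℝ)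

/-- For `F = D(u, ψ)`, the deviation of `(∂₂ψ, -∂₁ψ)` from `fieldA (∇u)`. -/
noncomputable def totalDefect (κ r : ℝ) (F : Plane →L[ℝ] ℝ × ℝ) : ℝ :=
  defect κ r (F (basisVec 0)).1 (F (basisVec 1)).2 +
    defect κ r (F (basisVec 1)).1 (-(F (basisVec 0)).2)

theorem totalDefect_nonneg (κ r : ℝ) (F : Plane →L[ℝ] ℝ × ℝ) : 0 ≤ totalDefect κ r F :=
  add_nonneg (defect_nonneg _ _ _ _) (defect_nonneg _ _ _ _)

theorem continuous_totalDefect {κ r : ℝ} (hr : 1 < r) : Continuous (totalDefect κ r) :=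
  (Continuous.defect hr (by fun_prop) (by fun_prop)).add
    (Continuous.defect hr (by fun_prop) (by fun_prop))

/-- The `r`-th power distance of the first rows of `F` and `G`. -/
noncomputable def gradDist (r : ℝ) (F G : Plane →L[ℝ] ℝ × ℝ) : ℝ :=
  |(F (basisVec 0)).1 - (G (basisVec 0)).1| ^ r + |(F (basisVec 1)).1 - (G (basisVec 1)).1| ^ r

theorem gradDist_nonneg (r : ℝ) (F G : Plane →L[ℝ] ℝ × ℝ) : 0 ≤ gradDist r F G := by
  unfold gradDist; positivity

theorem continuous_gradDist {r : ℝ} (hr : 1 < r) :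
    Continuous fun p : (Plane →L[ℝ] ℝ × ℝ) × (Plane →L[ℝ] ℝ × ℝ) => gradDist r p.1 p.2 := by
  unfold gradDist
  refine Continuous.add ?_ ?_ <;>
    exact Continuous.rpow_const (by fun_prop) fun p => Or.inr (by linarith)

/-- The linear map with first row `(x, y)` and second row `(-t, s)`. -/
noncomputable def stateMap (x s y t : ℝ) : Plane →L[ℝ] ℝ × ℝ :=
  rankOne 0 (x, -t) + rankOne 1 (y, s)

theorem stateMap_basisVec_zero (x s y t : ℝ) : stateMap x s y t (basisVec 0) = (x, -t) := by
  simp [stateMap, rankOne]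

theorem stateMap_basisVec_one (x s y t : ℝ) : stateMap x s y t (basisVec 1) = (y, s) := by
  simp [stateMap, rankOne]

theorem eq_stateMap (F : Plane →L[ℝ] ℝ × ℝ) :
    F = stateMap (F (basisVec 0)).1 (F (basisVec 1)).2 (F (basisVec 1)).1
      (-(F (basisVec 0)).2) := by
  refine ContinuousLinearMap.coe_injective
    ((EuclideanSpace.basisFun (Fin 2) ℝ).toBasis.ext ?_)
  have h0 := stateMap_basisVec_zero (F (basisVec 0)).1 (F (basisVec 1)).2 (F (basisVec 1)).1
    (-(F (basisVec 0)).2)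
  have h1 := stateMap_basisVec_one (F (basisVec 0)).1 (F (basisVec 1)).2 (F (basisVec 1)).1
    (-(F (basisVec 0)).2)
  rw [neg_neg] at h0
  intro i
  fin_cases i
  · simpa using h0.symm
  · simpa using h1.symm

theorem SeparatelyConvex.sub_const {g : ℝ → ℝ → ℝ} (hg : SeparatelyConvex g) (c : ℝ) :
    SeparatelyConvex fun x s => g x s - c :=
  ⟨fun s => (hg.1 s).sub (concaveOn_const c convex_univ),
    fun x => (hg.2 x).sub (concaveOn_const c convex_univ)⟩

/-- Moving `x` alters only the first column of the matrix and moving `s` only the second, so both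
are rank-one lines. -/
theorem separatelyConvex_relaxed_fst {f : (Plane →L[ℝ] ℝ × ℝ) → ℝ} (hf : Continuous f)
    (hf0 : ∀ G, 0 ≤ f G) (y t : ℝ) :
    SeparatelyConvex fun x s => relaxed f (stateMap x s y t) := by
  refine ⟨fun s => ?_, fun x => ?_⟩
  · convert convexOn_relaxed hf hf0 (stateMap 0 s y t) 0 ((1, 0) : ℝ × ℝ) using 3 with x
    ext v <;> simp [stateMap, rankOne]
    ring
  · convert convexOn_relaxed hf hf0 (stateMap x 0 y t) 1 ((0, 1) : ℝ × ℝ) using 3 with x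
    ext v <;> simp [stateMap, rankOne]
    ring

theorem separatelyConvex_relaxed_snd {f : (Plane →L[ℝ] ℝ × ℝ) → ℝ} (hf : Continuous f)
    (hf0 : ∀ G, 0 ≤ f G) (x s : ℝ) :
    SeparatelyConvex fun y t => relaxed f (stateMap x s y t) := by
  refine ⟨fun t => ?_, fun y => ?_⟩
  · convert convexOn_relaxed hf hf0 (stateMap x s 0 t) 1 ((1, 0) : ℝ × ℝ) using 3 with x
    ext v <;> simp [stateMap, rankOne]
    ring
  · convert convexOn_relaxed hf hf0 (stateMap x s y 0) 0 ((0, -1) : ℝ × ℝ) using 3 with x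
    ext v <;> simp [stateMap, rankOne]
    ring

/-- The scalar envelope bound is applied twice: in `(x, s)` with `(y, t)` frozen, then in `(y, t)`
at the point `(x₀, s₀)`. Each time the contribution of the other pair is subtracted as a constant.
-/
theorem exists_relaxed_le_totalDefect {κ r : ℝ} {L : ℕ} (hκ0 : 0 < κ) (hκ1 : κ < 1) (hL : 0 < L)
    (hr : 1 < r) (hrL : r < L / (1 + L) + (1 + κ) / ((1 + κ) + (1 - κ) * L)) :
    ∃ C : ℝ, 0 ≤ C ∧ ∀ K : ℝ, 0 ≤ K → ∀ G : Plane →L[ℝ] ℝ × ℝ,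
      relaxed (fun F => K * totalDefect κ r F + gradDist r F G) G ≤ C * totalDefect κ r G := by
  obtain ⟨C, hC, h⟩ := separatelyConvex_envelope_le hκ0 hκ1 hL hr hrL
  refine ⟨C, hC, fun K hK G => ?_⟩
  set f : (Plane →L[ℝ] ℝ × ℝ) → ℝ := fun F => K * totalDefect κ r F + gradDist r F G with hfdef
  have hf : Continuous f := ((continuous_totalDefect hr).const_mul K).add
    ((continuous_gradDist hr).comp (by fun_prop : Continuous fun F => (F, G)))
  have hf0 : ∀ F, 0 ≤ f F := fun F =>
    add_nonneg (mul_nonneg hK (totalDefect_nonneg _ _ _)) (gradDist_nonneg _ _ _)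
  set x₀ := (G (basisVec 0)).1 with hx₀
  set s₀ := (G (basisVec 1)).2 with hs₀
  set y₀ := (G (basisVec 1)).1 with hy₀
  set t₀ := -(G (basisVec 0)).2 with ht₀
  have hG : G = stateMap x₀ s₀ y₀ t₀ := eq_stateMap G
  have hle : ∀ x s y t, relaxed f (stateMap x s y t) ≤
      (K * defect κ r x s + |x - x₀| ^ r) + (K * defect κ r y t + |y - y₀| ^ r) := by
    intro x s y t
    refine (relaxed_le hf0 _).trans (le_of_eq ?_)
    simp only [hfdef, totalDefect, gradDist, stateMap_basisVec_zero, stateMap_basisVec_one,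
      neg_neg]
    ring
  have step1 : ∀ y t, relaxed f (stateMap x₀ s₀ y t) ≤
      C * defect κ r x₀ s₀ + (K * defect κ r y t + |y - y₀| ^ r) := by
    intro y t
    have := h x₀ s₀ K hK _ ((separatelyConvex_relaxed_fst hf hf0 y t).sub_const
      (K * defect κ r y t + |y - y₀| ^ r)) fun x s => by linarith [hle x s y t]
    linarith
  have step2 := h y₀ t₀ K hK _ ((separatelyConvex_relaxed_snd hf hf0 x₀ s₀).sub_const
      (C * defect κ r x₀ s₀)) fun y t => by linarith [step1 y t]
  rw [← hG] at step2
  have e : totalDefect κ r G = defect κ r x₀ s₀ + defect κ r y₀ t₀ := rfl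
  rw [e]
  linarith

/-! ### Convex integration. -/

/-- One step of convex integration: the deviation from the differential inclusion is made
arbitrarily small at the cost of a gradient perturbation controlled by the present deviation. -/
theorem exists_convex_integration_step {κ r : ℝ} {L : ℕ} (hκ0 : 0 < κ) (hκ1 : κ < 1) (hL : 0 < L)
    (hr : 1 < r) (hrL : r < L / (1 + L) + (1 + κ) / ((1 + κ) + (1 - κ) * L)) :
    ∃ C : ℝ, 0 ≤ C ∧ ∀ w : Plane → ℝ × ℝ, IsCellTest w → ∀ η > 0, ∃ w' : Plane → ℝ × ℝ,
      IsCellTest w' ∧ ∫ x in cell, totalDefect κ r (fderiv ℝ w' x) ≤ η ∧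
      ∫ x in cell, gradDist r (fderiv ℝ w' x) (fderiv ℝ w x) ≤
        C * (∫ x in cell, totalDefect κ r (fderiv ℝ w x)) + η ∧
      ∀ x, ‖w' x - w x‖ ≤ η := by
  obtain ⟨C, hC, h⟩ := exists_relaxed_le_totalDefect hκ0 hκ1 hL hr hrL
  refine ⟨C, hC, fun w hw η hη => ?_⟩
  have htd := continuous_totalDefect (κ := κ) hr
  set I := ∫ x in cell, totalDefect κ r (fderiv ℝ w x) with hI
  have hI0 : 0 ≤ I := integral_nonneg fun x => totalDefect_nonneg _ _ _
  -- The energy to be reached is `C * I + η`; dividing it by this penalty leaves a total defect of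
  -- at most `η`.
  set K := (C * I + η) / η with hK
  have hK0 : 0 < K := by positivity
  obtain ⟨w', hw', hint, hsup⟩ := exists_refinement
    (f := fun F G => K * totalDefect κ r F + gradDist r F G) (Φ := fun G => C * totalDefect κ r G)
    (((htd.comp continuous_fst).const_mul K).add (continuous_gradDist hr)) (htd.const_mul C)
    (fun G ε hε => by
      obtain ⟨v, hv, hvint⟩ := exists_setIntegral_lt_relaxed
        (f := fun F => K * totalDefect κ r F + gradDist r F G) G hε
      exact ⟨v, hv, hvint.le.trans (by linarith [h K hK0.le G])⟩) hw hη
  have c1 : Continuous fun x => totalDefect κ r (fderiv ℝ w' x) := htd.comp hw'.continuous_fderiv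
  have c2 : Continuous fun x => gradDist r (fderiv ℝ w' x) (fderiv ℝ w x) :=
    (continuous_gradDist hr).comp (hw'.continuous_fderiv.prodMk hw.continuous_fderiv)
  rw [integral_const_mul, integral_add (c1.const_mul K).integrableOn_cell c2.integrableOn_cell,
    integral_const_mul] at hint
  have n1 : 0 ≤ ∫ x in cell, totalDefect κ r (fderiv ℝ w' x) :=
    integral_nonneg fun x => totalDefect_nonneg _ _ _
  have n2 : 0 ≤ ∫ x in cell, gradDist r (fderiv ℝ w' x) (fderiv ℝ w x) :=
    integral_nonneg fun x => gradDist_nonneg _ _ _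
  refine ⟨w', hw', ?_, ?_, hsup⟩
  · have h1 : K * ∫ x in cell, totalDefect κ r (fderiv ℝ w' x) ≤ K * η := by
      have : K * η = C * I + η := by rw [hK]; field_simp
      linarith
    exact le_of_mul_le_mul_left h1 hK0
  · nlinarith [mul_nonneg hK0.le n1]

theorem exists_convex_integration_sequence {κ r : ℝ} {L : ℕ} (hκ0 : 0 < κ) (hκ1 : κ < 1)
    (hL : 0 < L) (hr : 1 < r) (hrL : r < L / (1 + L) + (1 + κ) / ((1 + κ) + (1 - κ) * L))
    {w₀ : Plane → ℝ × ℝ} (hw₀ : IsCellTest w₀) :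
    ∃ w : ℕ → Plane → ℝ × ℝ, w 0 = w₀ ∧ (∀ n, IsCellTest (w n)) ∧
      Tendsto (fun n => ∫ x in cell, totalDefect κ r (fderiv ℝ (w n) x)) atTop (𝓝 0) ∧
      (∃ C, 0 ≤ C ∧ ∀ n, ∫ x in cell, gradDist r (fderiv ℝ (w (n + 1)) x) (fderiv ℝ (w n) x) ≤
        C * ((1 / 2 : ℝ) ^ n) ^ r) ∧
      ∀ n x, ‖w (n + 1) x - w n x‖ ≤ (1 / 2) ^ (n + 2) := by
  obtain ⟨C, hC, hstep⟩ := exists_convex_integration_step hκ0 hκ1 hL hr hrL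
  -- The power `r` makes the `L^r` norms of the gradient increments geometric; the shift by `2`
  -- makes the uniform increments sum to at most `1/2`.
  set η : ℕ → ℝ := fun n => ((1 / 2 : ℝ) ^ (n + 2)) ^ r with hη
  have hη0 : ∀ n, 0 < η n := fun n => by positivity
  have hηle : ∀ n, η n ≤ (1 / 2) ^ (n + 2) := fun n => by
    have h1 : (1 / 2 : ℝ) ^ (n + 2) ≤ 1 := pow_le_one₀ (by norm_num) (by norm_num)
    calc η n ≤ ((1 / 2 : ℝ) ^ (n + 2)) ^ (1 : ℝ) :=
          Real.rpow_le_rpow_of_exponent_ge (by positivity) h1 hr.le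
      _ = _ := Real.rpow_one _
  choose! next hnext hnextI hnextD hnextS using hstep
  obtain ⟨W, hW0, hW⟩ : ∃ W : ℕ → Plane → ℝ × ℝ, W 0 = w₀ ∧ ∀ n, W (n + 1) = next (W n) (η n) :=
    ⟨fun n => Nat.rec w₀ (fun n v => next v (η n)) n, rfl, fun n => rfl⟩
  have hWt : ∀ n, IsCellTest (W n) := fun n => by
    induction n with
    | zero => rwa [hW0]
    | succ n ih => rw [hW]; exact hnext _ ih _ (hη0 n)
  set I : ℕ → ℝ := fun n => ∫ x in cell, totalDefect κ r (fderiv ℝ (W n) x) with hI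
  have hI0 : ∀ n, 0 ≤ I n := fun n => integral_nonneg fun x => totalDefect_nonneg _ _ _
  have hIle : ∀ n, I (n + 1) ≤ η n := fun n => by
    simp only [hI, hW]
    exact hnextI _ (hWt n) _ (hη0 n)
  have hηlim : Tendsto η atTop (𝓝 0) := by
    refine squeeze_zero (fun n => (hη0 n).le) hηle ?_
    exact (tendsto_pow_atTop_nhds_zero_of_lt_one (by norm_num) (by norm_num)).comp
      (tendsto_add_atTop_nat 2)
  refine ⟨W, hW0, hWt, ?_, ?_, fun n x => ?_⟩
  · exact (tendsto_add_atTop_iff_nat 1).1 (squeeze_zero (fun n => hI0 _) hIle hηlim)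
  -- The summand `C * I 0` covers the first step, where the defect of the starting map is not small.
  · refine ⟨C * I 0 + C + 1, by have := hI0 0; positivity, fun n => ?_⟩
    rw [hW]
    refine (hnextD _ (hWt n) _ (hη0 n)).trans ?_
    have h1 : η n ≤ ((1 / 2 : ℝ) ^ n) ^ r := by
      refine Real.rpow_le_rpow (by positivity) ?_ (by linarith)
      exact pow_le_pow_of_le_one (by norm_num) (by norm_num) (by omega)
    have h2 : I n ≤ (I 0 + 1) * ((1 / 2 : ℝ) ^ n) ^ r := by
      cases n with
      | zero => simp
      | succ n =>
        have h3 : η n ≤ ((1 / 2 : ℝ) ^ (n + 1)) ^ r := by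
          refine Real.rpow_le_rpow (by positivity) ?_ (by linarith)
          exact pow_le_pow_of_le_one (by norm_num) (by norm_num) (by omega)
        have h4 : (0 : ℝ) ≤ ((1 / 2 : ℝ) ^ (n + 1)) ^ r := by positivity
        exact ((hIle n).trans h3).trans (le_mul_of_one_le_left h4 (by linarith [hI0 0]))
    have h5 := mul_le_mul_of_nonneg_left h2 hC
    have e : ∫ x in cell, totalDefect κ r (fderiv ℝ (W n) x) = I n := rfl
    rw [e]
    linarith
  · rw [hW]
    exact (hnextS _ (hWt n) _ (hη0 n) x).trans (hηle n)

/-! ### Gradients, integration by parts and rotated gradients. -/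

theorem cell_subset_unitDisc : cell ⊆ (unitDisc : Set Plane) := fun x hx => by
  simpa [unitDisc] using norm_lt_one_of_mem_cell hx

namespace IsCellTest

theorem fst {w : Plane → ℝ × ℝ} (hw : IsCellTest w) : IsCellTest fun x => (w x).1 :=
  ⟨contDiff_fst.comp hw.contDiff,
    (tsupport_comp_subset (g := Prod.fst) rfl w).trans hw.tsupport_subset⟩

theorem snd {w : Plane → ℝ × ℝ} (hw : IsCellTest w) : IsCellTest fun x => (w x).2 :=
  ⟨contDiff_snd.comp hw.contDiff,
    (tsupport_comp_subset (g := Prod.snd) rfl w).trans hw.tsupport_subset⟩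

/-- A test map on the square as a test function on the disc. -/
def toTestFunction {u : Plane → ℝ} (hu : IsCellTest u) : 𝓓(unitDisc, ℝ) :=
  ⟨u, hu.contDiff, hu.hasCompactSupport,
    hu.tsupport_subset.trans (openCell_subset_cell.trans cell_subset_unitDisc)⟩

theorem gradient_eq_zero_of_notMem {u : Plane → ℝ} (hu : IsCellTest u) {x : Plane}
    (hx : x ∉ cell) : ∇ u x = 0 := by
  rw [gradient, hu.fderiv_eq_zero_of_notMem hx, map_zero]

end IsCellTest

theorem gradient_apply (u : Plane → ℝ) (x : Plane) (i : Fin 2) :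
    ∇ u x i = fderiv ℝ u x (basisVec i) := by
  rw [← toDual_gradient, InnerProductSpace.toDual_apply_apply, EuclideanSpace.inner_single_right]
  simp

theorem ContDiff.continuous_gradient {u : Plane → ℝ} (hu : ContDiff ℝ (⊤ : ℕ∞) u) :
    Continuous (∇ u) :=
  (InnerProductSpace.toDual ℝ Plane).symm.continuous.comp (hu.continuous_fderiv (by simp))

theorem HasCompactSupport.gradient {u : Plane → ℝ} (hu : HasCompactSupport u) :
    HasCompactSupport (∇ u) :=
  (hu.fderiv ℝ).comp_left (map_zero _)

theorem integral_mul_fderiv_eq_neg {u v : Plane → ℝ} (hu : ContDiff ℝ (⊤ : ℕ∞) u)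
    (hv : ContDiff ℝ (⊤ : ℕ∞) v) (hvc : HasCompactSupport v) (y : Plane) :
    ∫ x, u x * fderiv ℝ v x y = -∫ x, fderiv ℝ u x y * v x := by
  have hu1 : Continuous fun x => fderiv ℝ u x y := (hu.continuous_fderiv (by simp)).clm_apply
    continuous_const
  have hv1 : Continuous fun x => fderiv ℝ v x y := (hv.continuous_fderiv (by simp)).clm_apply
    continuous_const
  refine integral_mul_fderiv_eq_neg_fderiv_mul_of_integrable ?_ ?_ ?_
    (fun x _ => hu.differentiable (by simp) x) (fun x _ => hv.differentiable (by simp) x)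
  · exact (hu1.mul hv.continuous).integrable_of_hasCompactSupport hvc.mul_left
  · exact (hu.continuous.mul hv1).integrable_of_hasCompactSupport (hvc.fderiv_apply ℝ y).mul_left
  · exact (hu.continuous.mul hv.continuous).integrable_of_hasCompactSupport hvc.mul_left

theorem setIntegral_smul_gradient_eq_neg {Ω : Opens Plane} {u v : Plane → ℝ}
    (hu : ContDiff ℝ (⊤ : ℕ∞) u) (huc : HasCompactSupport u)
    (hv : ContDiff ℝ (⊤ : ℕ∞) v) (hvc : HasCompactSupport v)
    (hvΩ : tsupport v ⊆ Ω) :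
    ∫ x in (Ω : Set Plane), u x • ∇ v x = -∫ x in (Ω : Set Plane), v x • ∇ u x := by
  have hgv : ∀ x, x ∉ (Ω : Set Plane) → ∇ v x = 0 := fun x hx => by
    rw [gradient, fderiv_of_notMem_tsupport (𝕜 := ℝ) fun h => hx (hvΩ h), map_zero]
  have hv0 : ∀ x, x ∉ (Ω : Set Plane) → v x = 0 := fun x hx =>
    image_eq_zero_of_notMem_tsupport fun h => hx (hvΩ h)
  rw [setIntegral_eq_integral_of_forall_compl_eq_zero fun x hx => by rw [hgv x hx, smul_zero],
    setIntegral_eq_integral_of_forall_compl_eq_zero fun x hx => by rw [hv0 x hx, zero_smul]]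
  have i1 : Integrable fun x => u x • ∇ v x :=
    (hu.continuous.smul hv.continuous_gradient).integrable_of_hasCompactSupport huc.smul_right
  have i2 : Integrable fun x => v x • ∇ u x :=
    (hv.continuous.smul hu.continuous_gradient).integrable_of_hasCompactSupport hvc.smul_right
  ext i
  have e1 := (EuclideanSpace.proj i : Plane →L[ℝ] ℝ).integral_comp_comm i1
  have e2 := (EuclideanSpace.proj i : Plane →L[ℝ] ℝ).integral_comp_comm i2
  simp only [PiLp.proj_apply, PiLp.smul_apply, smul_eq_mul, gradient_apply] at e1 e2
  rw [PiLp.neg_apply, ← e1, ← e2, integral_mul_fderiv_eq_neg hu hv hvc]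
  simp_rw [mul_comm]

/-- Rotation of the plane by a quarter turn; it maps gradients to solenoidal fields. -/
noncomputable def quarterTurn (z : Plane) : Plane := !₂[z 1, -z 0]

theorem continuous_quarterTurn : Continuous quarterTurn := by
  unfold quarterTurn
  refine (PiLp.continuous_toLp 2 _).comp (continuous_pi fun i => ?_)
  fin_cases i <;> simp <;> fun_prop

/-- Moving the derivatives of `u` onto `v` leaves the difference of the two mixed second derivatives
of `v`, which agree. -/
theorem integral_inner_quarterTurn_gradient {u v : Plane → ℝ} (hu : ContDiff ℝ (⊤ : ℕ∞) u)
    (huc : HasCompactSupport u) (hv : ContDiff ℝ (⊤ : ℕ∞) v) :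
    ∫ x, ⟪quarterTurn (∇ u x), ∇ v x⟫_ℝ = 0 := by
  have hd : ∀ y, ContDiff ℝ (⊤ : ℕ∞) fun x => fderiv ℝ v x y := fun y =>
    (hv.fderiv_right (m := (⊤ : ℕ∞)) (by simp)).clm_apply contDiff_const
  have hc : ∀ y z, Integrable fun x => fderiv ℝ v x y * fderiv ℝ u x z := fun y z =>
    ((hd y).continuous.mul ((hu.continuous_fderiv (by simp)).clm_apply
      continuous_const)).integrable_of_hasCompactSupport (huc.fderiv_apply ℝ z).mul_left
  have e : ∀ x, ⟪quarterTurn (∇ u x), ∇ v x⟫_ℝ =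
      fderiv ℝ v x (basisVec 0) * fderiv ℝ u x (basisVec 1) -
        fderiv ℝ v x (basisVec 1) * fderiv ℝ u x (basisVec 0) := fun x => by
    simp only [PiLp.inner_apply, Fin.sum_univ_two, quarterTurn, ← gradient_apply]
    simp
    ring
  simp_rw [e]
  rw [integral_sub (hc _ _) (hc _ _), integral_mul_fderiv_eq_neg (hd _) hu huc,
    integral_mul_fderiv_eq_neg (hd _) hu huc, sub_eq_zero]
  congr 2
  ext x
  congr 1
  have hdd : DifferentiableAt ℝ (fderiv ℝ v) x :=
    (hv.fderiv_right (m := (⊤ : ℕ∞)) (by simp)).differentiable (by simp) x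
  have hs : ∀ y z, fderiv ℝ (fun x => fderiv ℝ v x y) x z = fderiv ℝ (fderiv ℝ v) x z y := by
    intro y z
    rw [fderiv_clm_apply hdd (differentiableAt_const y)]
    simp
  rw [hs, hs]
  exact (hv.contDiffAt.isSymmSndFDerivAt
    (by simpa using WithTop.coe_le_coe.2 (le_top : (2 : ℕ∞) ≤ ⊤))).eq _ _

/-! ### Growth and continuity of the field, and limits in `L^p`. -/

theorem fieldA_apply (θ : ℝ) (η : Plane) (i : Fin 2) : fieldA θ η i = wave (√θ) (η i) := by
  fin_cases i <;> simp [fieldA, wave]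

theorem continuous_wave (κ : ℝ) : Continuous (wave κ) := by
  unfold wave; fun_prop

theorem continuous_fieldA (θ : ℝ) : Continuous (fieldA θ) := by
  have : fieldA θ = fun η => WithLp.toLp 2 fun i => wave (√θ) (η i) := by
    ext η i; rw [fieldA_apply]
  rw [this]
  exact (PiLp.continuous_toLp 2 _).comp
    (continuous_pi fun i => (continuous_wave _).comp (by fun_prop))

theorem fieldA_zero (θ : ℝ) : fieldA θ 0 = 0 := by
  ext i; rw [fieldA_apply]; simp [wave]

theorem norm_le_abs_add_abs (z : Plane) : ‖z‖ ≤ |z 0| + |z 1| := by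
  rw [EuclideanSpace.norm_eq, Real.sqrt_le_left (by positivity), Fin.sum_univ_two]
  simp only [Real.norm_eq_abs]
  nlinarith [mul_nonneg (abs_nonneg (z 0)) (abs_nonneg (z 1))]

/-- The slope of `wave` grows with its argument, so no Lipschitz bound is available in general. The
remainder here is a bounded sine difference times `|y|`, which suits dominated convergence with `y`
the fixed limit. -/
theorem abs_wave_sub_le {κ : ℝ} (hκ : |κ| ≤ 1) (x y : ℝ) :
    |wave κ x - wave κ y| ≤
      2 * |x - y| + |Real.sin (Real.pi * x) - Real.sin (Real.pi * y)| * |y| := by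
  have e : wave κ x - wave κ y = (1 + κ * Real.sin (Real.pi * x)) * (x - y) +
      κ * ((Real.sin (Real.pi * x) - Real.sin (Real.pi * y)) * y) := by
    unfold wave; ring
  rw [e]
  refine (abs_add_le _ _).trans (add_le_add ?_ ?_)
  · rw [abs_mul]
    refine mul_le_mul_of_nonneg_right ?_ (abs_nonneg _)
    refine (abs_add_le _ _).trans ?_
    rw [abs_mul, abs_one]
    nlinarith [Real.abs_sin_le_one (Real.pi * x), abs_nonneg κ,
      abs_nonneg (Real.sin (Real.pi * x))]
  · rw [abs_mul, abs_mul]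
    exact mul_le_of_le_one_left (by positivity) hκ

theorem norm_fieldA_le {θ : ℝ} (hθ1 : θ ≤ 1) (η : Plane) :
    ‖fieldA θ η‖ ≤ 4 * ‖η‖ := by
  have hκ : |√θ| ≤ 1 := by
    rw [abs_of_nonneg (Real.sqrt_nonneg θ)]; exact Real.sqrt_le_one.2 hθ1
  refine (norm_le_abs_add_abs _).trans ?_
  rw [fieldA_apply, fieldA_apply]
  have h0 := PiLp.norm_apply_le η 0
  have h1 := PiLp.norm_apply_le η 1
  simp only [Real.norm_eq_abs] at h0 h1
  linarith [abs_wave_le hκ (η 0), abs_wave_le hκ (η 1)]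

theorem tendsto_integral_of_norm_sub_le {X F : Type*} [MeasurableSpace X] {μ : Measure X}
    [NormedAddCommGroup F] [NormedSpace ℝ F] {f : ℕ → X → F} {g : X → F} {d : ℕ → X → ℝ}
    (hf : ∀ n, Integrable (f n) μ) (hg : Integrable g μ) (hd : ∀ n, Integrable (d n) μ)
    (hle : ∀ n, ∀ᵐ x ∂μ, ‖f n x - g x‖ ≤ d n x)
    (hlim : Tendsto (fun n => ∫ x, d n x ∂μ) atTop (𝓝 0)) :
    Tendsto (fun n => ∫ x, f n x ∂μ) atTop (𝓝 (∫ x, g x ∂μ)) := by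
  rw [tendsto_iff_norm_sub_tendsto_zero]
  refine squeeze_zero (fun n => norm_nonneg _) (fun n => ?_) hlim
  rw [← integral_sub (hf n) hg]
  exact norm_integral_le_of_norm_le (hd n) (hle n)

section LpLimits

variable {X F : Type*} [MeasurableSpace X] {μ : Measure X} [NormedAddCommGroup F]

theorem exists_tendsto_eLpNorm_of_geometric [CompleteSpace F] {r : ℝ} (hr : 1 < r)
    {f : ℕ → X → F} (hf : ∀ n, MemLp (f n) (ENNReal.ofReal r) μ) {C : ℝ} (hC : 0 ≤ C)
    (hstep : ∀ n, ∫ x, ‖f (n + 1) x - f n x‖ ^ r ∂μ ≤ C * ((1 / 2 : ℝ) ^ n) ^ r) :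
    ∃ g, MemLp g (ENNReal.ofReal r) μ ∧
      Tendsto (fun n => eLpNorm (f n - g) (ENNReal.ofReal r) μ) atTop (𝓝 0) := by
  have hr0 : 0 < r := by linarith
  have : Fact (1 ≤ ENNReal.ofReal r) := ⟨by rw [ENNReal.one_le_ofReal]; exact hr.le⟩
  set G : ℕ → Lp F (ENNReal.ofReal r) μ := fun n => (hf n).toLp (f n) with hG
  have hdist : ∀ n, dist (G n) (G (n + 1)) ≤ C ^ r⁻¹ * (1 / 2) ^ n := by
    intro n
    rw [dist_comm, dist_edist, Lp.edist_toLp_toLp,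
      ((hf (n + 1)).sub (hf n)).eLpNorm_eq_integral_rpow_norm (by simpa using hr0)
      ENNReal.ofReal_ne_top, ENNReal.toReal_ofReal hr0.le, ENNReal.toReal_ofReal (by positivity)]
    refine (Real.rpow_le_rpow (by positivity) (hstep n) (by positivity)).trans (le_of_eq ?_)
    rw [Real.mul_rpow hC (by positivity), Real.rpow_rpow_inv (by positivity) hr0.ne']
  obtain ⟨g, hg⟩ := cauchySeq_tendsto_of_complete
    (cauchySeq_of_le_geometric (1 / 2) _ (by norm_num) hdist)
  refine ⟨g, Lp.memLp g, ?_⟩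
  rw [← Lp.tendsto_Lp_iff_tendsto_eLpNorm'' f hf g (Lp.memLp g), Lp.toLp_coeFn]
  exact hg

theorem tendsto_integral_norm_of_tendsto_eLpNorm [IsFiniteMeasure μ] {p : ℝ≥0∞} (hp : 1 ≤ p)
    {f : ℕ → X → F} (hf : ∀ n, AEStronglyMeasurable (f n) μ)
    (h : Tendsto (fun n => eLpNorm (f n) p μ) atTop (𝓝 0)) :
    Tendsto (fun n => ∫ x, ‖f n x‖ ∂μ) atTop (𝓝 0) := by
  have h1 : Tendsto (fun n => eLpNorm (f n) 1 μ) atTop (𝓝 0) := by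
    have hfin : μ univ ^ (1 / (1 : ℝ≥0∞).toReal - 1 / p.toReal) ≠ ∞ := by
      refine ENNReal.rpow_ne_top_of_nonneg ?_ (measure_ne_top μ univ)
      rw [ENNReal.toReal_one, div_one, sub_nonneg]
      rcases eq_or_ne p ∞ with rfl | hpt
      · simp
      · exact div_le_one_of_le₀ (by simpa using ENNReal.toReal_mono hpt hp) ENNReal.toReal_nonneg
    have h2 := ENNReal.Tendsto.mul_const (b := μ univ ^ (1 / (1 : ℝ≥0∞).toReal - 1 / p.toReal)) h
      (Or.inr hfin)
    rw [zero_mul] at h2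
    exact tendsto_of_tendsto_of_tendsto_of_le_of_le tendsto_const_nhds h2 (fun _ => zero_le)
      fun n => eLpNorm_le_eLpNorm_mul_rpow_measure_univ hp (hf n)
  have h3 := (ENNReal.tendsto_toReal ENNReal.zero_ne_top).comp h1
  refine h3.congr fun n => ?_
  rw [Function.comp_apply, eLpNorm_one_eq_lintegral_enorm, integral_norm_eq_lintegral_enorm (hf n)]

end LpLimits

theorem norm_fieldA_sub_le {θ : ℝ} (hθ1 : θ ≤ 1) (η ξ : Plane) :
    ‖fieldA θ η - fieldA θ ξ‖ ≤ 4 * ‖η - ξ‖ +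
      (|Real.sin (Real.pi * η 0) - Real.sin (Real.pi * ξ 0)| * |ξ 0| +
        |Real.sin (Real.pi * η 1) - Real.sin (Real.pi * ξ 1)| * |ξ 1|) := by
  have hκ : |√θ| ≤ 1 := by
    rw [abs_of_nonneg (Real.sqrt_nonneg θ)]; exact Real.sqrt_le_one.2 hθ1
  refine (norm_le_abs_add_abs _).trans ?_
  simp only [PiLp.sub_apply, fieldA_apply]
  have h0 := PiLp.norm_apply_le (η - ξ) 0
  have h1 := PiLp.norm_apply_le (η - ξ) 1
  simp only [Real.norm_eq_abs, PiLp.sub_apply] at h0 h1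
  linarith [abs_wave_sub_le hκ (η 0) (ξ 0), abs_wave_sub_le hκ (η 1) (ξ 1)]

theorem integrable_abs_sin_sub_mul {X : Type*} [MeasurableSpace X] {μ : Measure X}
    {f g : X → ℝ} (hf : AEStronglyMeasurable f μ) (hg : Integrable g μ) :
    Integrable (fun x => |Real.sin (Real.pi * f x) - Real.sin (Real.pi * g x)| * |g x|) μ := by
  have hs : ∀ {h : X → ℝ}, AEStronglyMeasurable h μ →
      AEStronglyMeasurable (fun x => Real.sin (Real.pi * h x)) μ := fun hh =>
    Real.continuous_sin.comp_aestronglyMeasurable (hh.const_mul Real.pi)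
  have hm : AEStronglyMeasurable
      (fun x => |Real.sin (Real.pi * f x) - Real.sin (Real.pi * g x)| * |g x|) μ :=
    ((hs hf).sub (hs hg.aestronglyMeasurable)).norm.mul hg.aestronglyMeasurable.norm
  refine (hg.abs.const_mul 2).mono' hm (ae_of_all _ fun x => ?_)
  rw [Real.norm_of_nonneg (by positivity)]
  refine mul_le_mul_of_nonneg_right ?_ (abs_nonneg _)
  refine (abs_sub _ _).trans ?_
  linarith [Real.abs_sin_le_one (Real.pi * f x), Real.abs_sin_le_one (Real.pi * g x)]

theorem tendsto_integral_abs_sin_sub_mul {X : Type*} [MeasurableSpace X] {μ : Measure X}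
    {f : ℕ → X → ℝ} {g : X → ℝ} (hf : ∀ n, AEStronglyMeasurable (f n) μ) (hg : Integrable g μ)
    (hfg : ∀ᵐ x ∂μ, Tendsto (fun n => f n x) atTop (𝓝 (g x))) :
    Tendsto (fun n => ∫ x, |Real.sin (Real.pi * f n x) - Real.sin (Real.pi * g x)| * |g x| ∂μ)
      atTop (𝓝 0) := by
  have := tendsto_integral_of_dominated_convergence (μ := μ) (f := fun _ => (0 : ℝ))
    (fun x => 2 * |g x|) (fun n => (integrable_abs_sin_sub_mul (hf n) hg).aestronglyMeasurable)
    (hg.abs.const_mul 2) (fun n => ae_of_all _ fun x => ?_) ?_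
  · simpa using this
  · rw [Real.norm_of_nonneg (by positivity)]
    refine mul_le_mul_of_nonneg_right ?_ (abs_nonneg _)
    refine (abs_sub _ _).trans ?_
    linarith [Real.abs_sin_le_one (Real.pi * f n x), Real.abs_sin_le_one (Real.pi * g x)]
  · filter_upwards [hfg] with x hx
    have c : Continuous fun z : ℝ =>
        |Real.sin (Real.pi * z) - Real.sin (Real.pi * g x)| * |g x| := by fun_prop
    have h := (c.tendsto (g x)).comp hx
    simp only [sub_self, abs_zero, zero_mul] at h
    exact h

/-- `fieldA` acts continuously on integrable fields, along a subsequence. -/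
theorem exists_subseq_tendsto_integral_fieldA {X : Type*} [MeasurableSpace X] {μ : Measure X}
    {θ : ℝ} (hθ1 : θ ≤ 1) {f : ℕ → X → Plane} {g : X → Plane} (hf : ∀ n, Integrable (f n) μ)
    (hg : Integrable g μ) (h : Tendsto (fun n => ∫ x, ‖f n x - g x‖ ∂μ) atTop (𝓝 0)) :
    ∃ ns : ℕ → ℕ, StrictMono ns ∧
      Tendsto (fun n => ∫ x, ‖fieldA θ (f (ns n) x) - fieldA θ (g x)‖ ∂μ) atTop (𝓝 0) := by
  have hL1 : Tendsto (fun n => eLpNorm (f n - g) 1 μ) atTop (𝓝 0) := by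
    have : ∀ n, eLpNorm (f n - g) 1 μ = ENNReal.ofReal (∫ x, ‖f n x - g x‖ ∂μ) := fun n => by
      rw [eLpNorm_one_eq_lintegral_enorm]
      exact (ofReal_integral_norm_eq_lintegral_enorm ((hf n).sub hg)).symm
    simp_rw [this]
    simpa using ENNReal.tendsto_ofReal h
  -- The sine terms need pointwise convergence, hence the subsequence.
  obtain ⟨ns, hns, hae⟩ := (tendstoInMeasure_of_tendsto_eLpNorm one_ne_zero
    (fun n => (hf n).aestronglyMeasurable) hg.aestronglyMeasurable hL1).exists_seq_tendsto_ae
  refine ⟨ns, hns, ?_⟩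
  have hcoord : ∀ i : Fin 2, Continuous fun z : Plane => z i := fun i => by fun_prop
  have hgi : ∀ i : Fin 2, Integrable (fun x => g x i) μ := fun i => by
    refine hg.norm.mono' ((hcoord i).comp_aestronglyMeasurable hg.aestronglyMeasurable)
      (ae_of_all _ fun x => ?_)
    exact PiLp.norm_apply_le (g x) i
  have hfi : ∀ (i : Fin 2) n, AEStronglyMeasurable (fun x => f (ns n) x i) μ := fun i n =>
    (hcoord i).comp_aestronglyMeasurable (hf (ns n)).aestronglyMeasurable
  have hS := fun (i : Fin 2) n => integrable_abs_sin_sub_mul (hfi i n) (hgi i)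
  have hSlim := fun i : Fin 2 => tendsto_integral_abs_sin_sub_mul (hfi i) (hgi i) (by
    filter_upwards [hae] with x hx
    exact ((hcoord i).tendsto (g x)).comp hx)
  have hA := ((h.comp hns.tendsto_atTop).const_mul 4).add ((hSlim 0).add (hSlim 1))
  simp only [mul_zero, add_zero] at hA
  refine squeeze_zero (fun n => integral_nonneg fun x => norm_nonneg _) (fun n => ?_) hA
  have hi : Integrable (fun x => ‖f (ns n) x - g x‖) μ := ((hf (ns n)).sub hg).norm
  have hS01 : Integrable (fun x =>
      |Real.sin (Real.pi * f (ns n) x 0) - Real.sin (Real.pi * g x 0)| * |g x 0| +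
        |Real.sin (Real.pi * f (ns n) x 1) - Real.sin (Real.pi * g x 1)| * |g x 1|) μ :=
    (hS 0 n).add (hS 1 n)
  rw [Function.comp_apply, ← integral_const_mul, ← integral_add (hS 0 n) (hS 1 n),
    ← integral_add (hi.const_mul 4) hS01]
  exact integral_mono_of_nonneg (ae_of_all _ fun x => norm_nonneg _)
    ((hi.const_mul 4).add hS01)
    (ae_of_all _ fun x => norm_fieldA_sub_le hθ1 _ _)

/-! ### Passage to the limit in the equation. -/

theorem quarterTurn_zero : quarterTurn 0 = 0 := by
  ext i; fin_cases i <;> simp [quarterTurn]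

instance isFiniteMeasure_restrict_unitDisc :
    IsFiniteMeasure (volume.restrict (unitDisc : Set Plane)) :=
  ⟨by rw [Measure.restrict_apply_univ]; exact measure_ball_lt_top⟩

set_option maxHeartbeats 800000 in
/-- Limits of smooth approximations that satisfy the equation up to errors vanishing in `L¹` are
solutions of the Dirichlet problem. -/
theorem isDirichletSolution_of_approximation {θ r : ℝ} (hθ1 : θ ≤ 1) (hr : 1 < r)
    {v ψ : ℕ → Plane → ℝ} (hv : ∀ n, IsCellTest (v n)) (hψ : ∀ n, IsCellTest (ψ n))
    {u : Plane → ℝ} {δ : ℕ → ℝ} (hδ : Tendsto δ atTop (𝓝 0)) (hvu : ∀ n x, ‖v n x - u x‖ ≤ δ n)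
    {C : ℝ} (hC : 0 ≤ C)
    (hstep : ∀ n, ∫ x in (unitDisc : Set Plane), ‖∇ (v (n + 1)) x - ∇ (v n) x‖ ^ r ≤
      C * ((1 / 2 : ℝ) ^ n) ^ r)
    (herr : Tendsto (fun n => ∫ x in (unitDisc : Set Plane),
      ‖fieldA θ (∇ (v n) x) - quarterTurn (∇ (ψ n) x)‖) atTop (𝓝 0)) :
    IsDirichletSolution unitDisc (fieldA θ) (ENNReal.ofReal r) u := by
  set μ := volume.restrict (unitDisc : Set Plane) with hμ
  set p := ENNReal.ofReal r with hp
  have hp1 : 1 ≤ p := by rw [hp, ENNReal.one_le_ofReal]; exact hr.le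
  have hucont : Continuous u := by
    have : TendstoUniformly v u atTop := by
      rw [Metric.tendstoUniformly_iff]
      intro ε hε
      filter_upwards [hδ.eventually (gt_mem_nhds hε)] with n hn x
      rw [dist_comm, dist_eq_norm]
      exact (hvu n x).trans_lt hn
    exact this.continuous (Eventually.of_forall fun n => (hv n).contDiff.continuous).frequently
  obtain ⟨b, -, hb⟩ := (hv 0).exists_bound
  have hub : ∀ x, ‖u x‖ ≤ b + δ 0 := fun x => by
    have h1 := norm_sub_norm_le (u x) (v 0 x)
    rw [norm_sub_rev] at h1
    linarith [hvu 0 x, hb x]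
  have hupm : MemLp u p μ := MemLp.of_bound hucont.aestronglyMeasurable _ (ae_of_all _ hub)
  have hgc : ∀ n, Continuous (∇ (v n)) := fun n => (hv n).contDiff.continuous_gradient
  have hgs : ∀ n, HasCompactSupport (∇ (v n)) := fun n => (hv n).hasCompactSupport.gradient
  have hgp : ∀ n, MemLp (∇ (v n)) p μ := fun n =>
    ((hgc n).memLp_of_hasCompactSupport (hgs n)).restrict _
  obtain ⟨g, hg, hglim⟩ := exists_tendsto_eLpNorm_of_geometric hr hgp hC hstep
  have hgi : Integrable g μ := hg.integrable hp1
  have hgni : ∀ n, Integrable (∇ (v n)) μ := fun n => (hgp n).integrable hp1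
  have hg1 : Tendsto (fun n => ∫ x, ‖∇ (v n) x - g x‖ ∂μ) atTop (𝓝 0) :=
    tendsto_integral_norm_of_tendsto_eLpNorm hp1
      (fun n => ((hgp n).sub hg).aestronglyMeasurable) hglim
  have hu_loc : LocallyIntegrableOn u unitDisc volume :=
    hucont.locallyIntegrable.locallyIntegrableOn _
  have hg_loc : LocallyIntegrableOn g unitDisc volume :=
    IntegrableOn.locallyIntegrableOn hgi
  have hvcont : ∀ n, Continuous (v n) := fun n => (hv n).contDiff.continuous
  have hvi : ∀ n, Integrable (v n) μ := fun n =>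
    ((hvcont n).integrable_of_hasCompactSupport (hv n).hasCompactSupport).restrict
  have hui : Integrable u μ := hupm.integrable hp1
  have hδint : Tendsto (fun n => ∫ _, δ n ∂μ) atTop (𝓝 0) := by
    simp_rw [integral_const, smul_eq_mul]
    simpa using hδ.const_mul (μ.real univ)
  have hweak : HasWeakGradient unitDisc u g := by
    refine ⟨hu_loc, hg_loc, fun φ => ?_⟩
    obtain ⟨b₁, hb₁⟩ := φ.continuous.bounded_above_of_compact_support φ.hasCompactSupport
    have hφc := φ.contDiff.continuous_gradient
    obtain ⟨b₂, hb₂⟩ := hφc.bounded_above_of_compact_support φ.hasCompactSupport.gradient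
    have hb₂0 : 0 ≤ b₂ := (norm_nonneg _).trans (hb₂ 0)
    have hb₁0 : 0 ≤ b₁ := (norm_nonneg _).trans (hb₁ 0)
    have l1 : Tendsto (fun n => ∫ x, v n x • ∇ φ x ∂μ) atTop (𝓝 (∫ x, u x • ∇ φ x ∂μ)) := by
      refine tendsto_integral_of_norm_sub_le (d := fun n _ => δ n * b₂)
        (fun n => (hvi n).smul_bdd b₂ hφc.aestronglyMeasurable (ae_of_all _ hb₂))
        (hui.smul_bdd b₂ hφc.aestronglyMeasurable (ae_of_all _ hb₂))
        (fun n => integrable_const _) (fun n => ae_of_all _ fun x => ?_) ?_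
      · rw [← sub_smul, norm_smul]
        exact mul_le_mul (hvu n x) (hb₂ x) (norm_nonneg _) ((norm_nonneg _).trans (hvu n x))
      · simp_rw [integral_mul_const]
        simpa using hδint.mul_const b₂
    have l2 : Tendsto (fun n => ∫ x, φ x • ∇ (v n) x ∂μ) atTop (𝓝 (∫ x, φ x • g x ∂μ)) := by
      refine tendsto_integral_of_norm_sub_le (d := fun n x => b₁ * ‖∇ (v n) x - g x‖)
        (fun n => (hgni n).bdd_smul b₁ φ.continuous.aestronglyMeasurable (ae_of_all _ hb₁))
        (hgi.bdd_smul b₁ φ.continuous.aestronglyMeasurable (ae_of_all _ hb₁))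
        (fun n => ((hgni n).sub hgi).norm.const_mul b₁) (fun n => ae_of_all _ fun x => ?_) ?_
      · rw [← smul_sub, norm_smul]
        exact mul_le_mul_of_nonneg_right (hb₁ x) (norm_nonneg _)
      · simp_rw [integral_const_mul]
        simpa using hg1.const_mul b₁
    refine tendsto_nhds_unique (l1.congr fun n => ?_) l2.neg
    exact setIntegral_smul_gradient_eq_neg (hv n).contDiff (hv n).hasCompactSupport φ.contDiff
      φ.hasCompactSupport φ.tsupport_subset
  have hAm : ∀ {f : Plane → Plane}, Integrable f μ → Integrable (fun x => fieldA θ (f x)) μ :=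
    fun hf => (hf.norm.const_mul 4).mono'
      ((continuous_fieldA θ).comp_aestronglyMeasurable hf.aestronglyMeasurable)
      (ae_of_all _ fun x => norm_fieldA_le hθ1 _)
  refine ⟨⟨hupm, g, hweak, hg, fun n => (hv n).toTestFunction, ?_, ?_⟩, g, hweak, ?_, fun φ => ?_⟩
  · have hlim : Tendsto (fun n => μ univ ^ p.toReal⁻¹ * ENNReal.ofReal (δ n)) atTop (𝓝 0) := by
      have h1 := ENNReal.Tendsto.const_mul (a := μ univ ^ p.toReal⁻¹)
        (ENNReal.tendsto_ofReal hδ) (Or.inr (ENNReal.rpow_ne_top_of_nonneg (by positivity)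
          (measure_ne_top μ univ)))
      simpa using h1
    refine tendsto_of_tendsto_of_tendsto_of_le_of_le tendsto_const_nhds hlim (fun _ => zero_le)
      fun n => eLpNorm_le_of_ae_bound (ae_of_all _ (hvu n))
  · exact hglim
  · exact IntegrableOn.locallyIntegrableOn (hAm hgi)
  · obtain ⟨ns, hns, hA⟩ := exists_subseq_tendsto_integral_fieldA hθ1 hgni hgi hg1
    have hφc := φ.contDiff.continuous_gradient
    obtain ⟨b₂, hb₂⟩ := hφc.bounded_above_of_compact_support φ.hasCompactSupport.gradient
    have hb₂0 : 0 ≤ b₂ := (norm_nonneg _).trans (hb₂ 0)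
    set σ : ℕ → Plane → Plane := fun n x => quarterTurn (∇ (ψ n) x) with hσ
    have hσc : ∀ n, Continuous (σ n) := fun n =>
      continuous_quarterTurn.comp (hψ n).contDiff.continuous_gradient
    have hσs : ∀ n, HasCompactSupport (σ n) := fun n =>
      (hψ n).hasCompactSupport.gradient.comp_left (g := quarterTurn) quarterTurn_zero
    have hσi : ∀ n, Integrable (σ n) μ := fun n =>
      ((hσc n).integrable_of_hasCompactSupport (hσs n)).restrict
    have hinner : ∀ {f : Plane → Plane}, Integrable f μ →
        Integrable (fun x => ⟪f x, ∇ φ x⟫_ℝ) μ := fun {f} hf => by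
      refine (hf.norm.const_mul b₂).mono'
        (hf.aestronglyMeasurable.inner hφc.aestronglyMeasurable) (ae_of_all _ fun x => ?_)
      refine (norm_inner_le_norm _ _).trans ?_
      rw [mul_comm]
      exact mul_le_mul_of_nonneg_right (hb₂ x) (norm_nonneg _)
    have hzero : ∀ n, ∫ x, ⟪σ n x, ∇ φ x⟫_ℝ ∂μ = 0 := fun n => by
      rw [hμ, setIntegral_eq_integral_of_forall_compl_eq_zero]
      · exact integral_inner_quarterTurn_gradient (hψ n).contDiff (hψ n).hasCompactSupport
          φ.contDiff
      · intro x hx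
        rw [gradient, fderiv_of_notMem_tsupport (𝕜 := ℝ) fun h => hx (φ.tsupport_subset h),
          map_zero, inner_zero_right]
    -- The fields `σ (ns n)` approach `fieldA θ (g x)` in `L¹` through `fieldA θ (∇ (v (ns n)) x)`;
    -- each of them pairs to zero with `∇ φ`.
    have h1 : Tendsto (fun n => ∫ x, ⟪σ (ns n) x, ∇ φ x⟫_ℝ ∂μ) atTop
        (𝓝 (∫ x, ⟪fieldA θ (g x), ∇ φ x⟫_ℝ ∂μ)) := by
      refine tendsto_integral_of_norm_sub_le
        (d := fun n x => b₂ * (‖fieldA θ (∇ (v (ns n)) x) - fieldA θ (g x)‖ +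
          ‖fieldA θ (∇ (v (ns n)) x) - σ (ns n) x‖))
        (fun n => hinner (hσi (ns n))) (hinner (hAm hgi))
        (fun n => (((hAm (hgni (ns n))).sub (hAm hgi)).norm.add
          ((hAm (hgni (ns n))).sub (hσi (ns n))).norm).const_mul b₂)
        (fun n => ae_of_all _ fun x => ?_) ?_
      · rw [← inner_sub_left]
        refine (norm_inner_le_norm _ _).trans ?_
        rw [mul_comm]
        refine mul_le_mul (hb₂ x) ?_ (norm_nonneg _) hb₂0
        rw [norm_sub_rev (fieldA θ (∇ (v (ns n)) x)) (σ (ns n) x), add_comm]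
        exact norm_sub_le_norm_sub_add_norm_sub _ _ _
      · have e : ∀ n, ∫ x, b₂ * (‖fieldA θ (∇ (v (ns n)) x) - fieldA θ (g x)‖ +
            ‖fieldA θ (∇ (v (ns n)) x) - σ (ns n) x‖) ∂μ =
            b₂ * ((∫ x, ‖fieldA θ (∇ (v (ns n)) x) - fieldA θ (g x)‖ ∂μ) +
              ∫ x, ‖fieldA θ (∇ (v (ns n)) x) - σ (ns n) x‖ ∂μ) := fun n => by
          have i1 := ((hAm (hgni (ns n))).sub (hAm hgi)).norm
          have i2 := ((hAm (hgni (ns n))).sub (hσi (ns n))).norm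
          simp only [Pi.sub_apply] at i1 i2
          rw [integral_const_mul, integral_add i1 i2]
        simp_rw [e]
        simpa using (hA.add (herr.comp hns.tendsto_atTop)).const_mul b₂
    simp_rw [hzero] at h1
    exact tendsto_nhds_unique h1 tendsto_const_nhds

/-! ### From matrix estimates to the nontrivial solution. -/

theorem norm_rpow_gradient_sub_le_gradDist {r : ℝ} (hr : 1 < r) {w w' : Plane → ℝ × ℝ}
    (hw : IsCellTest w) (hw' : IsCellTest w') (x : Plane) :
    ‖∇ (fun y => (w' y).1) x - ∇ (fun y => (w y).1) x‖ ^ r ≤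
      2 ^ (r - 1) * gradDist r (fderiv ℝ w' x) (fderiv ℝ w x) := by
  have h1 : ∀ {v : Plane → ℝ × ℝ}, IsCellTest v → ∀ i,
      ∇ (fun y => (v y).1) x i = (fderiv ℝ v x (basisVec i)).1 := fun {v} hv i => by
    rw [gradient_apply, (hv.differentiable x).hasFDerivAt.fst.fderiv]
    rfl
  have h2 := norm_le_abs_add_abs (∇ (fun y => (w' y).1) x - ∇ (fun y => (w y).1) x)
  simp only [PiLp.sub_apply, h1 hw, h1 hw'] at h2
  refine (Real.rpow_le_rpow (norm_nonneg _) h2 (by linarith)).trans ?_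
  have h3 := NNReal.rpow_add_le_mul_rpow_add_rpow
    ‖(fderiv ℝ w' x (basisVec 0)).1 - (fderiv ℝ w x (basisVec 0)).1‖₊
    ‖(fderiv ℝ w' x (basisVec 1)).1 - (fderiv ℝ w x (basisVec 1)).1‖₊ hr.le
  exact_mod_cast h3

theorem norm_fieldA_sub_quarterTurn_le_totalDefect {θ r : ℝ} (hr : 1 < r) {w : Plane → ℝ × ℝ}
    (hw : IsCellTest w) (x : Plane) :
    ‖fieldA θ (∇ (fun y => (w y).1) x) - quarterTurn (∇ (fun y => (w y).2) x)‖ ≤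
      totalDefect (√θ) r (fderiv ℝ w x) := by
  have h1 : ∀ i, ∇ (fun y => (w y).1) x i = (fderiv ℝ w x (basisVec i)).1 := fun i => by
    rw [gradient_apply, (hw.differentiable x).hasFDerivAt.fst.fderiv]
    rfl
  have h2 : ∀ i, ∇ (fun y => (w y).2) x i = (fderiv ℝ w x (basisVec i)).2 := fun i => by
    rw [gradient_apply, (hw.differentiable x).hasFDerivAt.snd.fderiv]
    rfl
  refine (norm_le_abs_add_abs _).trans ?_
  simp only [PiLp.sub_apply, fieldA_apply, h1, quarterTurn]
  refine add_le_add ?_ ?_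
  · simpa [h2] using abs_sub_le_defect (κ := √θ) hr _ (fderiv ℝ w x (basisVec 1)).2
  · simpa [h2] using abs_sub_le_defect (κ := √θ) hr _ (-(fderiv ℝ w x (basisVec 0)).2)

theorem isDirichletSolution_zero (θ : ℝ) (p : ℝ≥0∞) :
    IsDirichletSolution unitDisc (fieldA θ) p 0 := by
  have hweak : HasWeakGradient unitDisc 0 0 :=
    ⟨locallyIntegrableOn_zero, locallyIntegrableOn_zero, fun φ => by simp⟩
  have hgrad : ∇ (0 : Plane → ℝ) = 0 := by ext1 x; simp [gradient]
  refine ⟨⟨MemLp.zero, 0, hweak, MemLp.zero, fun _ => 0, ?_, ?_⟩, 0, hweak, ?_, fun φ => ?_⟩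
  · simp
  · simp [hgrad]
  · simpa [fieldA_zero] using locallyIntegrableOn_zero
  · simp [fieldA_zero]

theorem theorem1p1 (θ : ℝ) (hθ0 : 0 < θ) (hθ1 : θ < 1) (r : ℝ) (hr1 : 1 < r) (hr2 : r < qBar θ) :
    IsDirichletSolution unitDisc (fieldA θ) (ENNReal.ofReal r) 0 ∧
    ∃ u : Plane → ℝ,
      IsDirichletSolution unitDisc (fieldA θ) (ENNReal.ofReal r) u ∧
      ¬ (u =ᵐ[volume.restrict (unitDisc : Set Plane)] 0) := by
  refine ⟨isDirichletSolution_zero θ _, ?_⟩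
  obtain ⟨L, hL, hrL⟩ := exists_step_of_lt_qBar hθ0 hθ1 hr2
  have hκ0 : 0 < √θ := Real.sqrt_pos.2 hθ0
  have hκ1 : √θ < 1 := by rw [Real.sqrt_lt' one_pos]; simpa using hθ1
  -- The iteration starts from `(χ, 0)`. Since the square has measure `1`, losing at most `1/2`
  -- forces the set on which `χ = 1` to be nonempty.
  obtain ⟨χ, K, hχ, hK, hKc, hKm, hχ01, hχ1⟩ := exists_cutoff (show (0 : ℝ) < 1 / 2 by norm_num)
  obtain ⟨x₀, hx₀⟩ : K.Nonempty := by
    by_contra hne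
    rw [not_nonempty_iff_eq_empty.1 hne, sdiff_empty, measureReal_def, volume_cell] at hKm
    norm_num at hKm
  have hw₀ : IsCellTest fun x => (χ x, (0 : ℝ)) :=
    ⟨hχ.contDiff.prodMk contDiff_const,
      (tsupport_comp_subset (g := fun t : ℝ => (t, (0 : ℝ))) rfl χ).trans hχ.tsupport_subset⟩
  obtain ⟨w, hw0, hw, hdef, ⟨C, hC, hstep⟩, hsup⟩ :=
    exists_convex_integration_sequence hκ0 hκ1 hL hr1 hrL hw₀
  have hdist : ∀ x n, dist (w n x).1 (w (n + 1) x).1 ≤ 1 / 4 * (1 / 2) ^ n := fun x n => by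
    rw [dist_comm, dist_eq_norm]
    refine ((norm_fst_le (w (n + 1) x - w n x)).trans (hsup n x)).trans (le_of_eq ?_)
    ring
  choose u hu using fun x => cauchySeq_tendsto_of_complete
    (cauchySeq_of_le_geometric (1 / 2) (1 / 4) (by norm_num) (hdist x))
  have hvu : ∀ n x, ‖(w n x).1 - u x‖ ≤ 1 / 2 * (1 / 2) ^ n := fun n x => by
    rw [← dist_eq_norm]
    refine (dist_le_of_le_geometric_of_tendsto (1 / 2) (1 / 4) (by norm_num) (hdist x) (hu x)
      n).trans (le_of_eq ?_)
    ring
  have hδ : Tendsto (fun n : ℕ => (1 / 2 : ℝ) * (1 / 2) ^ n) atTop (𝓝 0) := by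
    rw [← mul_zero (1 / 2 : ℝ)]
    exact (tendsto_pow_atTop_nhds_zero_of_lt_one (by norm_num) (by norm_num)).const_mul _
  have htd := continuous_totalDefect (κ := √θ) hr1
  have hsol : IsDirichletSolution unitDisc (fieldA θ) (ENNReal.ofReal r) u := by
    refine isDirichletSolution_of_approximation hθ1.le hr1 (fun n => (hw n).fst)
      (fun n => (hw n).snd) hδ hvu (C := 2 ^ (r - 1) * C) (by positivity) (fun n => ?_) ?_
    · have c1 : Continuous fun x => ‖∇ (fun y => (w (n + 1) y).1) x - ∇ (fun y => (w n y).1) x‖ ^ r :=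
        ((hw (n + 1)).fst.contDiff.continuous_gradient.sub
          (hw n).fst.contDiff.continuous_gradient).norm.rpow_const fun x => Or.inr (by linarith)
      have c2 : Continuous fun x => gradDist r (fderiv ℝ (w (n + 1)) x) (fderiv ℝ (w n) x) :=
        (continuous_gradDist hr1).comp
          ((hw (n + 1)).continuous_fderiv.prodMk (hw n).continuous_fderiv)
      rw [setIntegral_eq_of_subset_of_forall_sdiff_eq_zero unitDisc.isOpen.measurableSet
        cell_subset_unitDisc fun x hx => by
          rw [(hw (n + 1)).fst.gradient_eq_zero_of_notMem hx.2,
            (hw n).fst.gradient_eq_zero_of_notMem hx.2, sub_zero, norm_zero,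
            Real.zero_rpow (by linarith)]]
      calc _ ≤ ∫ x in cell, 2 ^ (r - 1) * gradDist r (fderiv ℝ (w (n + 1)) x) (fderiv ℝ (w n) x) :=
            setIntegral_mono c1.integrableOn_cell (c2.const_mul _).integrableOn_cell fun x =>
              norm_rpow_gradient_sub_le_gradDist hr1 (hw n) (hw (n + 1)) x
        _ = 2 ^ (r - 1) * ∫ x in cell, gradDist r (fderiv ℝ (w (n + 1)) x) (fderiv ℝ (w n) x) :=
            integral_const_mul _ _
        _ ≤ 2 ^ (r - 1) * (C * ((1 / 2 : ℝ) ^ n) ^ r) := by gcongr; exact hstep n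
        _ = _ := by ring
    · refine squeeze_zero (fun n => integral_nonneg fun x => norm_nonneg _) (fun n => ?_) hdef
      have c1 : Continuous fun x =>
          ‖fieldA θ (∇ (fun y => (w n y).1) x) - quarterTurn (∇ (fun y => (w n y).2) x)‖ :=
        (((continuous_fieldA θ).comp (hw n).fst.contDiff.continuous_gradient).sub
          (continuous_quarterTurn.comp (hw n).snd.contDiff.continuous_gradient)).norm
      rw [setIntegral_eq_of_subset_of_forall_sdiff_eq_zero unitDisc.isOpen.measurableSet
        cell_subset_unitDisc fun x hx => by
          rw [(hw n).fst.gradient_eq_zero_of_notMem hx.2,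
            (hw n).snd.gradient_eq_zero_of_notMem hx.2, fieldA_zero, quarterTurn_zero, sub_zero,
            norm_zero]]
      exact setIntegral_mono c1.integrableOn_cell
        (htd.comp (hw n).continuous_fderiv).integrableOn_cell fun x =>
          norm_fieldA_sub_quarterTurn_le_totalDefect hr1 (hw n) x
  refine ⟨u, hsol, fun hu0 => ?_⟩
  -- Near `x₀` the starting function equals `1`, and `u` differs from it by at most `1/2`.
  have hev : ∀ᶠ x in 𝓝 x₀, u x ≠ 0 := by
    filter_upwards [hχ1 x₀ hx₀] with x hx hux
    have h := hvu 0 x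
    rw [hw0, hux] at h
    simp only [hx] at h
    norm_num at h
  obtain ⟨U, hU, hUo, hxU⟩ := eventually_nhds_iff.1
    (hev.and (unitDisc.isOpen.mem_nhds (cell_subset_unitDisc (hKc hx₀))))
  have hpos : 0 < volume U := hUo.measure_pos _ ⟨x₀, hxU⟩
  have hzero : volume U = 0 := by
    rw [EventuallyEq, ae_restrict_iff' unitDisc.isOpen.measurableSet] at hu0
    refine measure_mono_null (fun x hx => ?_) hu0
    exact fun h => (hU x hx).1 (h (hU x hx).2)
  exact hpos.ne' hzero
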